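/- There are constants $c>0$ and $C$ such that the following holds for every integer $n\ge 1$. Let the edges of the complete directed graph on $n$ vertices (all ordered pairs $(a,b)$ with $a\ne b$) be assigned independent random weights, each uniformly distributed on $[0,1]$. A path is a sequence of one or more vertices in which consecutive vertices are distinct, and its length is the sum of the weights of its edges; a path with a single vertex is empty and has length $0$. A path is a shortest path if no path with the same first vertex and the same last vertex has smaller length. A path with at least one edge is a locally shortest path (LSP) if the path obtained by deleting its first edge and the path obtained by deleting its last edge are both shortest paths. Let $\mathcal{LSP}$ be the set of all locally shortest paths. Then $$\Pr\bigl[\,|\mathcal{LSP}|\ge c\,n^2\,\bigr]\;\le\; C\,n^{-1/26}.$$ -/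

import Mathlib

open MeasureTheory ProbabilityTheory

namespace RandomAPSP

variable {V : Type*}

/-- A path of the complete directed graph on the vertex set `V`, given by its sequence of
vertices: a nonempty sequence in which consecutive vertices are distinct (no self-loops).
A one-vertex sequence is an empty path (it has no edges). Vertices may repeat; when all weights
are positive, the shortest paths below never repeat a vertex. -/
def IsPath (p : List V) : Prop :=
  p ≠ [] ∧ p.IsChain (· ≠ ·)

/-- The length of a path: the sum of the weights of its edges. -/
def pathWeight (w : V → V → ℝ) : List V → ℝ
  | [] => 0
  | [_] => 0
  | u :: v :: p => w u v + pathWeight w (v :: p)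

/-- A shortest path: a path of minimum length among all paths with the same first vertex
and the same last vertex. -/
def IsShortestPath (w : V → V → ℝ) (p : List V) : Prop :=
  IsPath p ∧ ∀ q : List V, IsPath q → q.head? = p.head? → q.getLast? = p.getLast? →
    pathWeight w p ≤ pathWeight w q

/-- A locally shortest path: a path with at least one edge such that the path obtained by
deleting its first edge and the path obtained by deleting its last edge are both shortest
paths. -/
def IsLSP (w : V → V → ℝ) (p : List V) : Prop :=
  IsPath p ∧ 2 ≤ p.length ∧ IsShortestPath w p.tail ∧ IsShortestPath w p.dropLast

/-- The number of locally shortest paths, as an element of `ℕ∞`. -/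
noncomputable def numLSP (w : V → V → ℝ) : ℕ∞ :=
  {p : List V | IsLSP w p}.encard

end RandomAPSP

/-! Write a locally shortest path with at least two edges as `a :: (q ++ [b])`, where `q` runs from
`x` to `y`. Without ties, the shortest paths from `x` are the branches of a tree. So `q` is
determined by `(x, y)`, `b` is a child of `y` in the tree of `x`, and `a` is a child of `x` in the
tree of `y` for the reversed weights. Summing the products of these two child counts over `(x, y)`
and using 2uv ≤ u² + v², it suffices to show that the squared child counts over all n trees sum to
O(n²) (`two_mul_numLSP_le`).

Each tree is grown by Dijkstra's algorithm. Given the history, the edges leaving the explored set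
carry independent uniform weights conditioned to exceed known thresholds. While arrivals stay below
1/2, each of these N edges is next with probability at most 2/N (`lmarginal_race_le`,
`edgeMeasure_runSet_cons_le`). The parent of the new vertex is thus dominated by twice the uniform
law on the explored set, and the sum S of squared child counts has drift at most 6 per step. The
positive part of S - 6k then has second moment at most 58k (`sum_runProb_mul_excess_sq_le`).

Trees of different sources are dependent, but Markov's inequality for the sum of these second
moments, followed by Cauchy–Schwarz, bounds the total by 7n² outside an event of probability 58/n.
Arrivals exceed 1/2 only with exponentially small probability (`edgeMeasure_not_hasShortPaths_le`),
and reversing all edges preserves the law. The outcome is at most 8n² paths outside an event of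
probability O(1/n), much stronger than the exponent 1/26. -/

namespace RandomAPSP

/-! ### Dijkstra's algorithm as a deterministic process on histories. -/

section Exploration

variable {V : Type*} [DecidableEq V]

/-- The set of vertices reached from `s` by a history, a list of pairs (parent, child) with the
newest first. -/
def explored (s : V) : List (V × V) → Finset V
  | [] => {s}
  | e :: h => insert e.2 (explored s h)

/-- The length of the path to a vertex in the tree described by a history. -/
noncomputable def arrival (w : V → V → ℝ) : List (V × V) → V → ℝ
  | [] => fun _ => 0
  | e :: h => Function.update (arrival w h) e.2 (arrival w h e.1 + w e.1 e.2)

/-- The arrival time of the vertex reached last. -/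
noncomputable def lastArrival (w : V → V → ℝ) : List (V × V) → ℝ
  | [] => 0
  | e :: h => arrival w h e.1 + w e.1 e.2

/-- The part of the event that Dijkstra's algorithm follows a given history that concerns
the edges between explored vertices. -/
def IsInner (w : V → V → ℝ) (s : V) : List (V × V) → Prop
  | [] => True
  | e :: h => IsInner w s h ∧ e.1 ∈ explored s h ∧ e.2 ∉ explored s h ∧
      lastArrival w h < arrival w h e.1 + w e.1 e.2 ∧
      ∀ j ∈ explored s h, j ≠ e.1 → arrival w h e.1 + w e.1 e.2 < arrival w h j + w j e.2

/-- Dijkstra's algorithm started from `s` follows the given history. -/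
def IsRun (w : V → V → ℝ) (s : V) (h : List (V × V)) : Prop :=
  IsInner w s h ∧ ∀ j ∈ explored s h, ∀ v ∉ explored s h, lastArrival w h < arrival w h j + w j v

/-- Every step of the history leads from an explored vertex to a new one. -/
def IsGrowth (s : V) : List (V × V) → Prop
  | [] => True
  | e :: h => IsGrowth s h ∧ e.1 ∈ explored s h ∧ e.2 ∉ explored s h

lemma source_mem_explored (s : V) (h : List (V × V)) : s ∈ explored s h := by
  induction h with
  | nil => simp [explored]
  | cons e h ih => simp [explored, ih]

variable {w : V → V → ℝ} {s : V} {h : List (V × V)}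

lemma IsInner.isGrowth (H : IsInner w s h) : IsGrowth s h := by
  induction h with
  | nil => trivial
  | cons e h ih => exact ⟨ih H.1, H.2.1, H.2.2.1⟩

lemma IsGrowth.card_explored (H : IsGrowth s h) : (explored s h).card = h.length + 1 := by
  induction h with
  | nil => simp [explored]
  | cons e h ih => simp [explored, Finset.card_insert_of_notMem H.2.2, ih H.1]

lemma IsGrowth.snd_mem (H : IsGrowth s h) {e : V × V} (he : e ∈ h) : e.2 ∈ explored s h := by
  induction h with
  | nil => simp at he
  | cons f h ih =>
    rcases List.mem_cons.1 he with rfl | he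
    · exact Finset.mem_insert_self _ _
    · exact Finset.mem_insert_of_mem (ih H.1 he)

lemma IsGrowth.snd_ne_source (H : IsGrowth s h) {e : V × V} (he : e ∈ h) : e.2 ≠ s := by
  induction h with
  | nil => simp at he
  | cons f h ih =>
    rcases List.mem_cons.1 he with rfl | he
    · exact fun hs => H.2.2 (hs ▸ source_mem_explored s h)
    · exact ih H.1 he

/-- A vertex enters the explored set only once, because every step ends at a new vertex. -/
lemma IsGrowth.fst_unique (H : IsGrowth s h) {y z v : V} (hy : (y, v) ∈ h) (hz : (z, v) ∈ h) :
    y = z := by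
  induction h with
  | nil => simp at hy
  | cons f h ih =>
    rcases List.mem_cons.1 hy with rfl | hy' <;> rcases List.mem_cons.1 hz with hz' | hz'
    · exact (congrArg Prod.fst hz').symm
    · exact absurd (H.1.snd_mem hz') H.2.2
    · subst hz'
      exact absurd (H.1.snd_mem hy') H.2.2
    · exact ih H.1 hy' hz'

lemma IsGrowth.arrival_source (H : IsGrowth s h) : arrival w h s = 0 := by
  induction h with
  | nil => rfl
  | cons e h ih =>
    have : s ≠ e.2 := fun hs => H.2.2 (hs ▸ source_mem_explored s h)
    simp [arrival, this, ih H.1]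

lemma IsInner.arrival_le (H : IsInner w s h) {j : V} (hj : j ∈ explored s h) :
    0 ≤ arrival w h j ∧ arrival w h j ≤ lastArrival w h := by
  induction h generalizing j with
  | nil => simp [arrival, lastArrival]
  | cons e h ih =>
    have h0 := ih H.1 (source_mem_explored s h)
    by_cases hje : j = e.2
    · subst hje
      simp only [arrival, lastArrival, Function.update_self, le_refl, and_true]
      linarith [H.2.2.2.1]
    · have := ih H.1 (Finset.mem_of_mem_insert_of_ne hj hje)
      simp only [arrival, lastArrival, ne_eq, hje, not_false_eq_true, Function.update_of_ne]
      exact ⟨this.1, this.2.trans H.2.2.2.1.le⟩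

/-- The inner condition compares `e` with the other edges into `e.2`, and the crossing condition
after the step compares it with all remaining edges of the old cut. Together they make `e` the
strict minimizer over that cut. -/
lemma IsRun.of_cons {e : V × V} (H : IsRun w s (e :: h)) :
    IsRun w s h ∧ e.1 ∈ explored s h ∧ e.2 ∉ explored s h ∧
      lastArrival w h < lastArrival w (e :: h) ∧
      ∀ j ∈ explored s h, ∀ v ∉ explored s h, (j, v) ≠ e →
        arrival w h e.1 + w e.1 e.2 < arrival w h j + w j v := by
  obtain ⟨⟨hin, h1, h2, hlt, hmin⟩, hcross⟩ := H
  have key : ∀ j ∈ explored s h, ∀ v ∉ explored s h, (j, v) ≠ e →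
      arrival w h e.1 + w e.1 e.2 < arrival w h j + w j v := by
    intro j hj v hv hne
    by_cases hve : v = e.2
    · subst hve
      exact hmin j hj fun hje => hne (by rw [hje])
    · have := hcross j (Finset.mem_insert_of_mem hj) v
        (by simp only [explored, Finset.mem_insert]; tauto)
      have hje : j ≠ e.2 := fun hje => h2 (hje ▸ hj)
      simpa [arrival, lastArrival, hje] using this
  refine ⟨⟨hin, fun j hj v hv => ?_⟩, h1, h2, hlt, key⟩
  by_cases hne : (j, v) = e
  · subst hne
    exact hlt
  · exact hlt.trans (key j hj v hv hne)

/-- Arrival times are a feasible potential whose tight edges lie in the tree. An edge back to an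
earlier vertex is never tight, since arrivals increase and weights are positive. -/
lemma IsInner.arrival_step (hw : ∀ a b, a ≠ b → 0 < w a b) (H : IsInner w s h) {z v : V}
    (hz : z ∈ explored s h) (hv : v ∈ explored s h) (hzv : z ≠ v) :
    arrival w h v ≤ arrival w h z + w z v ∧
      (arrival w h v = arrival w h z + w z v → (z, v) ∈ h) := by
  induction h with
  | nil =>
    simp only [explored, Finset.mem_singleton] at hz hv
    exact absurd (hz.trans hv.symm) hzv
  | cons e h ih =>
    by_cases hve : v = e.2
    · subst hve
      have hz' := Finset.mem_of_mem_insert_of_ne hz hzv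
      simp only [arrival, Function.update_self, ne_eq, hzv, not_false_eq_true,
        Function.update_of_ne]
      by_cases hze : z = e.1
      · subst hze
        simp
      · have := H.2.2.2.2 z hz' hze
        exact ⟨this.le, fun h' => absurd h' this.ne⟩
    · have hv' := Finset.mem_of_mem_insert_of_ne hv hve
      by_cases hze : z = e.2
      · subst hze
        have h1 := (H.1.arrival_le hv').2
        have h2 := H.2.2.2.1
        have h3 := hw _ _ hzv
        simp only [arrival, Function.update_self, ne_eq, hve, not_false_eq_true,
          Function.update_of_ne]
        exact ⟨by linarith, fun h' => by linarith⟩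
      · have hz' := Finset.mem_of_mem_insert_of_ne hz hze
        simp only [arrival, ne_eq, hve, hze, not_false_eq_true, Function.update_of_ne]
        exact ⟨(ih H.1 hz' hv').1, fun h' => List.mem_cons_of_mem _ ((ih H.1 hz' hv').2 h')⟩

end Exploration

/-! ### Path weights: concatenation, reversal, and splitting a locally shortest path. -/

section Paths

variable {V : Type*}

lemma pathWeight_concat (w : V → V → ℝ) (q : List V) (y b : V) :
    pathWeight w (q ++ [y, b]) = pathWeight w (q ++ [y]) + w y b := by
  induction q with
  | nil => simp [pathWeight]
  | cons x q ih =>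
    cases q with
    | nil => simp [pathWeight]
    | cons z q =>
      simp only [List.cons_append, pathWeight] at ih ⊢
      linarith

lemma pathWeight_reverse (w : V → V → ℝ) (p : List V) :
    pathWeight (fun a b => w b a) p.reverse = pathWeight w p := by
  induction p with
  | nil => rfl
  | cons x q ih =>
    cases q with
    | nil => rfl
    | cons z q =>
      have : (x :: z :: q).reverse = q.reverse ++ [z, x] := by simp
      rw [this, pathWeight_concat]
      simp only [List.reverse_cons] at ih
      simp only [pathWeight]
      linarith

lemma IsPath.reverse {p : List V} (hp : IsPath p) : IsPath p.reverse := by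
  refine ⟨by simpa using hp.1, ?_⟩
  rw [List.isChain_reverse]
  exact hp.2.imp fun _ _ h => h.symm

lemma IsShortestPath.reverse {w : V → V → ℝ} {p : List V} (hp : IsShortestPath w p) :
    IsShortestPath (fun a b => w b a) p.reverse := by
  refine ⟨hp.1.reverse, fun q hq h1 h2 => ?_⟩
  have := hp.2 q.reverse hq.reverse (by simpa using h2) (by simpa using h1)
  have h3 := pathWeight_reverse (fun a b => w b a) q
  rw [pathWeight_reverse, ← h3]
  exact this

lemma pathWeight_congr {w w' : V → V → ℝ} (hw : ∀ a b, a ≠ b → w a b = w' a b) {p : List V}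
    (hp : p.IsChain (· ≠ ·)) : pathWeight w p = pathWeight w' p := by
  induction p with
  | nil => rfl
  | cons x q ih =>
    cases q with
    | nil => rfl
    | cons z q =>
      rw [List.isChain_cons_cons] at hp
      simp only [pathWeight, hw _ _ hp.1, ih hp.2]

lemma isShortestPath_congr {w w' : V → V → ℝ} (hw : ∀ a b, a ≠ b → w a b = w' a b)
    {p : List V} : IsShortestPath w p ↔ IsShortestPath w' p := by
  unfold IsShortestPath
  refine and_congr_right fun hp => forall₂_congr fun q hq => ?_
  rw [pathWeight_congr hw hp.2, pathWeight_congr hw hq.2]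

/-- Paths have no self-loops, so diagonal values are irrelevant; this allows the weights to be
replaced by a function on edges only. -/
lemma numLSP_congr {w w' : V → V → ℝ} (hw : ∀ a b, a ≠ b → w a b = w' a b) :
    numLSP w = numLSP w' := by
  unfold numLSP IsLSP
  simp only [isShortestPath_congr hw]

lemma IsLSP.exists_decomposition {w : V → V → ℝ} {p : List V} (hp : IsLSP w p)
    (h3 : 3 ≤ p.length) : ∃ (x y a b : V) (q : List V), p = a :: (q ++ [b]) ∧
      q.head? = some x ∧ q.getLast? = some y ∧ IsShortestPath w (a :: q) ∧
      IsShortestPath w (q ++ [b]) := by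
  obtain ⟨a, p, rfl⟩ := List.exists_cons_of_ne_nil hp.1.1
  rcases List.eq_nil_or_concat p with rfl | ⟨q, b, rfl⟩
  · simp at h3
  simp only [List.concat_eq_append] at *
  have hq : q ≠ [] := by
    rintro rfl
    simp at h3
  refine ⟨q.head hq, q.getLast hq, a, b, q, rfl, List.head?_eq_some_head hq,
    List.getLast?_eq_some_getLast hq, ?_, hp.2.2.1⟩
  have := hp.2.2.2
  rwa [← List.cons_append, List.dropLast_concat] at this

end Paths

/-! ### Shortest paths are the branches of the exploration tree. -/

section Tree

variable {V : Type*} [DecidableEq V] {w : V → V → ℝ} {s : V} {h : List (V × V)}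

lemma IsInner.exists_path (H : IsInner w s h) {v : V} (hv : v ∈ explored s h) :
    ∃ q : List V, IsPath (q ++ [v]) ∧ (q ++ [v]).head? = some s ∧
      pathWeight w (q ++ [v]) = arrival w h v := by
  induction h generalizing v with
  | nil =>
    simp only [explored, Finset.mem_singleton] at hv
    subst hv
    exact ⟨[], by simp [IsPath], by simp, by simp [pathWeight, arrival]⟩
  | cons e h ih =>
    by_cases hve : v = e.2
    · subst hve
      obtain ⟨q, hq, hs, hqw⟩ := ih H.1 H.2.1
      refine ⟨q ++ [e.1], ⟨by simp, ?_⟩, by simpa using hs, ?_⟩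
      · have := hq.2
        rw [List.isChain_append] at this ⊢
        refine ⟨by rw [List.isChain_append]; exact this, by simp, ?_⟩
        intro x hx y hy
        simp only [List.getLast?_append, List.getLast?_singleton, Option.some_or,
          Option.mem_def, Option.some.injEq, List.head?_cons] at hx hy
        subst hx hy
        exact fun h12 => H.2.2.1 (h12 ▸ H.2.1)
      · rw [List.append_assoc, List.singleton_append, pathWeight_concat, hqw]
        simp [arrival]
    · obtain ⟨q, hq⟩ := ih H.1 (Finset.mem_of_mem_insert_of_ne hv hve)
      refine ⟨q, ?_⟩
      simpa [arrival, hve] using hq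

/-- The potential inequality telescopes along the path, and equality forces every edge to be tight,
hence a tree edge. -/
lemma IsInner.arrival_le_pathWeight (hw : ∀ a b, a ≠ b → 0 < w a b)
    (H : IsInner w s h) (hfull : ∀ v, v ∈ explored s h)
    (a : V) (p : List V) (hp : (a :: p).IsChain (· ≠ ·)) :
    arrival w h ((a :: p).getLast (by simp)) ≤ arrival w h a + pathWeight w (a :: p) ∧
    (arrival w h ((a :: p).getLast (by simp)) = arrival w h a + pathWeight w (a :: p) →
      (a :: p).IsChain (fun y b => (y, b) ∈ h)) := by
  induction p generalizing a with
  | nil => simp [pathWeight]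
  | cons b p ih =>
    rw [List.isChain_cons_cons] at hp
    obtain ⟨h1, h2⟩ := ih b hp.2
    obtain ⟨h3, h4⟩ := H.arrival_step hw (hfull a) (hfull b) hp.1
    simp only [pathWeight, List.getLast_cons_cons, List.isChain_cons_cons]
    exact ⟨by linarith, fun heq => ⟨h4 (by linarith), h2 (by linarith)⟩⟩

lemma IsInner.isChain_of_isShortestPath (hw : ∀ a b, a ≠ b → 0 < w a b)
    (H : IsInner w s h) (hfull : ∀ v, v ∈ explored s h)
    {p : List V} (hp : IsShortestPath w p) (hs : p.head? = some s) :
    p.IsChain (fun y b => (y, b) ∈ h) := by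
  obtain ⟨a, p, rfl⟩ := List.exists_cons_of_ne_nil hp.1.1
  obtain rfl : a = s := by simpa using hs
  obtain ⟨h1, h2⟩ := H.arrival_le_pathWeight hw hfull a p hp.1.2
  refine h2 (le_antisymm h1 ?_)
  obtain ⟨q, hq, hqs, hqw⟩ := H.exists_path (hfull ((a :: p).getLast (by simp)))
  have h3 := hp.2 _ hq (by rw [hqs]; simp) (by simp [List.getLast?_eq_some_getLast])
  rw [H.isGrowth.arrival_source, zero_add, ← hqw]
  exact h3

/-- Going back from the common last vertex, unique parents force the two chains to agree. They stop
together because the root has no parent. -/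
lemma IsGrowth.isChain_unique (H : IsGrowth s h) (n : ℕ) (p q : List V) (hn : p.length = n)
    (hp : p.IsChain (fun y b => (y, b) ∈ h)) (hq : q.IsChain (fun y b => (y, b) ∈ h))
    (hps : p.head? = some s) (hqs : q.head? = some s) (hl : p.getLast? = q.getLast?) :
    p = q := by
  induction n generalizing p q with
  | zero => simp_all
  | succ n ih =>
    rcases List.eq_nil_or_concat p with rfl | ⟨p, b, rfl⟩
    · simp at hps
    rcases List.eq_nil_or_concat q with rfl | ⟨q, b', rfl⟩
    · simp at hqs
    simp only [List.concat_eq_append] at *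
    obtain rfl : b = b' := by simpa using hl
    rcases List.eq_nil_or_concat p with rfl | ⟨p, y, rfl⟩
    · obtain rfl : b = s := by simpa using hps
      rcases List.eq_nil_or_concat q with rfl | ⟨q, z, rfl⟩
      · rfl
      · simp only [List.concat_eq_append, List.append_assoc, List.singleton_append] at hq
        have := (List.isChain_append.1 hq).2.1
        exact absurd rfl (H.snd_ne_source (List.isChain_pair.1 this))
    · simp only [List.concat_eq_append, List.append_assoc, List.singleton_append] at *
      have hyb := List.isChain_pair.1 (List.isChain_append.1 hp).2.1
      rcases List.eq_nil_or_concat q with rfl | ⟨q, z, rfl⟩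
      · obtain rfl : b = s := by simpa using hqs
        exact absurd rfl (H.snd_ne_source hyb)
      · simp only [List.concat_eq_append, List.append_assoc, List.singleton_append] at *
        have hzb := List.isChain_pair.1 (List.isChain_append.1 hq).2.1
        obtain rfl := H.fst_unique hyb hzb
        have hp' : (p ++ [y]).IsChain (fun y b => (y, b) ∈ h) :=
          hp.prefix ⟨[b], by simp⟩
        have hq' : (q ++ [y]).IsChain (fun y b => (y, b) ∈ h) :=
          hq.prefix ⟨[b], by simp⟩
        have := ih (p ++ [y]) (q ++ [y]) (by simpa using hn) hp' hq' (by simpa using hps)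
          (by simpa using hqs) (by simp)
        rw [show p ++ [y, b] = (p ++ [y]) ++ [b] by simp, this]
        simp

end Tree

/-! ### Bounding the number of locally shortest paths by squared child counts. -/

section Counting

variable {V : Type*} [DecidableEq V]

/-- The number of children of a vertex in the tree described by a history. -/
def childCount (h : List (V × V)) (y : V) : ℕ := h.countP (fun e => e.1 = y)

/-- The sum of the squares of the numbers of children. -/
def sqChildCount [Fintype V] (h : List (V × V)) : ℕ := ∑ y, childCount h y ^ 2

lemma childCount_cons (e : V × V) (h : List (V × V)) (y : V) :
    childCount (e :: h) y = childCount h y + if y = e.1 then 1 else 0 := by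
  simp [childCount, List.countP_cons, eq_comm]

lemma card_le_childCount {h : List (V × V)} {y : V} {B : Finset V} (hB : ∀ b ∈ B, (y, b) ∈ h) :
    B.card ≤ childCount h y := by
  have hsub : B.image (fun b => (y, b)) ⊆ (h.filter (fun e => e.1 = y)).toFinset := by
    intro e he
    obtain ⟨b, hb, rfl⟩ := Finset.mem_image.1 he
    simpa using hB b hb
  calc B.card = (B.image (fun b => (y, b))).card :=
        (Finset.card_image_of_injective _ (Prod.mk_right_injective y)).symm
    _ ≤ _ := Finset.card_le_card hsub
    _ ≤ _ := List.toFinset_card_le _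
    _ = _ := by rw [childCount, List.countP_eq_length_filter]

lemma sum_childCount [Fintype V] (h : List (V × V)) : ∑ y, childCount h y = h.length := by
  induction h with
  | nil => simp [childCount]
  | cons e h ih => simp [childCount_cons, Finset.sum_add_distrib, ih]

lemma sqChildCount_cons [Fintype V] (e : V × V) (h : List (V × V)) :
    sqChildCount (e :: h) = sqChildCount h + (2 * childCount h e.1 + 1) := by
  have : ∀ y, childCount (e :: h) y ^ 2 = childCount h y ^ 2 +
      if y = e.1 then 2 * childCount h e.1 + 1 else 0 := by
    intro y
    rw [childCount_cons]
    split_ifs with hy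
    · subst hy
      ring
    · ring
  simp [sqChildCount, this, Finset.sum_add_distrib]

/-- The potential inequality is applied to the two-edge path from the source to the vertex reached
last. -/
lemma IsInner.lastArrival_le {w : V → V → ℝ} {s : V} {h : List (V × V)} (H : IsInner w s h)
    (hw : ∀ a b, a ≠ b → 0 < w a b) (hfull : ∀ v, v ∈ explored s h) {r : ℝ} (hr : 0 ≤ r)
    (hshort : ∀ a b, a ≠ b → ∃ v, v ≠ a ∧ v ≠ b ∧ w a v ≤ r ∧ w v b ≤ r) :
    lastArrival w h ≤ 2 * r := by
  cases h with
  | nil => simpa [lastArrival] using hr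
  | cons e h =>
    have hes : s ≠ e.2 := fun hs => H.2.2.1 (hs ▸ source_mem_explored s h)
    have hlast : lastArrival w (e :: h) = arrival w (e :: h) e.2 := by
      simp [lastArrival, arrival]
    obtain ⟨v, hvs, hve, h1, h2⟩ := hshort s e.2 hes
    have h3 := (H.arrival_step hw (hfull s) (hfull v) hvs.symm).1
    have h4 := (H.arrival_step hw (hfull v) (hfull e.2) hve).1
    rw [H.isGrowth.arrival_source] at h3
    rw [hlast]
    linarith

variable [Fintype V]

/-- The number of locally shortest paths is bounded through the squares of the numbers of
children in the shortest path trees, for the given and for the reversed weights. -/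
lemma two_mul_numLSP_le {w : V → V → ℝ} (hw : ∀ a b, a ≠ b → 0 < w a b)
    (R R' : V → List (V × V)) (hR : ∀ s, IsInner w s (R s))
    (hR' : ∀ s, IsInner (fun a b => w b a) s (R' s)) (hfull : ∀ s v, v ∈ explored s (R s))
    (hfull' : ∀ s v, v ∈ explored s (R' s)) :
    2 * numLSP w ≤ ((2 * Fintype.card V ^ 2 + ∑ s, sqChildCount (R s) +
      ∑ s, sqChildCount (R' s) : ℕ) : ℕ∞) := by
  -- With `t = (x, y)` the ends of the middle segment, these are the candidates for the first and
  -- the last vertex of the whole path.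
  let A : V × V → Finset V := fun t => {a | (t.1, a) ∈ R' t.2}
  let B : V × V → Finset V := fun t => {b | (t.2, b) ∈ R t.1}
  let T : Finset ((_ : V × V) × (V × V)) := Finset.univ.sigma fun t => A t ×ˢ B t
  have hT : 2 * T.card ≤ ∑ s, sqChildCount (R s) + ∑ s, sqChildCount (R' s) := by
    rw [Finset.card_sigma, Finset.mul_sum]
    calc ∑ t : V × V, 2 * (A t ×ˢ B t).card
        ≤ ∑ t : V × V, (childCount (R t.1) t.2 ^ 2 + childCount (R' t.2) t.1 ^ 2) := by
          refine Finset.sum_le_sum fun t _ => ?_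
          have h1 : (A t).card ≤ childCount (R' t.2) t.1 :=
            card_le_childCount fun a ha => by simpa [A] using ha
          have h2 : (B t).card ≤ childCount (R t.1) t.2 :=
            card_le_childCount fun a ha => by simpa [B] using ha
          rw [Finset.card_product]
          have h3 := Nat.mul_le_mul h1 h2
          zify at h3 ⊢
          nlinarith [sq_nonneg ((childCount (R t.1) t.2 : ℤ) - childCount (R' t.2) t.1)]
      _ = _ := by
          rw [Finset.sum_add_distrib, Fintype.sum_prod_type, Fintype.sum_prod_type_right]
          rfl
  have hlong : {p | IsLSP w p ∧ 3 ≤ p.length}.encard ≤ T.card := by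
    have hex : ∀ p : {p | IsLSP w p ∧ 3 ≤ p.length}, ∃ t : T, ∃ q : List V,
        p.1 = t.1.2.1 :: (q ++ [t.1.2.2]) ∧ q.head? = some t.1.1.1 ∧
        q.getLast? = some t.1.1.2 ∧ q.IsChain (fun y b => (y, b) ∈ R t.1.1.1) := by
      rintro ⟨p, hp, h3⟩
      obtain ⟨x, y, a, b, q, hpq, hx, hy, hs1, hs2⟩ := hp.exists_decomposition h3
      have hc := (hR x).isChain_of_isShortestPath hw (hfull x) hs2
        (by rw [List.head?_append, hx]; rfl)
      have hc' := (hR' y).isChain_of_isShortestPath (fun a b hab => hw b a hab.symm) (hfull' y)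
        hs1.reverse (by simp [hy, List.head?_append])
      rw [List.reverse_cons, List.isChain_append] at hc'
      rw [List.isChain_append] at hc
      refine ⟨⟨⟨(x, y), (a, b)⟩, ?_⟩, q, hpq, hx, hy, hc.1⟩
      simp only [T, A, B, Finset.mem_sigma, Finset.mem_univ, true_and, Finset.mem_product,
        Finset.mem_filter]
      exact ⟨hc'.2.2 x (by simp [hx]) a (by simp), hc.2.2 y (by simp [hy]) b (by simp)⟩
    choose f q hf using hex
    -- The middle segment is recovered from its ends as the unique branch of the tree, so the four
    -- vertices `(x, y), (a, b)` determine the path.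
    have hinj : Function.Injective f := by
      intro p p' hpp
      obtain ⟨h1, h2, h3, h4⟩ := hf p
      obtain ⟨h1', h2', h3', h4'⟩ := hf p'
      rw [← hpp] at h1' h2' h3' h4'
      have := (hR _).isGrowth.isChain_unique _ (q p) (q p') rfl h4 h4' h2 h2' (h3.trans h3'.symm)
      exact Subtype.ext (by rw [h1, h1', this])
    have := Function.Embedding.encard_le (s := {p | IsLSP w p ∧ 3 ≤ p.length})
      (t := (T : Set ((_ : V × V) × (V × V)))) ⟨f, hinj⟩
    rwa [Set.encard_coe_eq_coe_finsetCard] at this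
  have hshort : {p | IsLSP w p ∧ p.length < 3}.encard ≤ (Fintype.card V ^ 2 : ℕ) := by
    have hsub : {p | IsLSP w p ∧ p.length < 3} ⊆
        (fun t : V × V => [t.1, t.2]) '' Set.univ := by
      rintro p ⟨hp, hp3⟩
      have hp2 : p.length = 2 := le_antisymm (by omega) hp.2.1
      obtain ⟨a, b, rfl⟩ := List.length_eq_two.1 hp2
      exact ⟨(a, b), trivial, rfl⟩
    refine (Set.encard_le_encard hsub).trans ((Set.encard_image_le _ _).trans ?_)
    rw [Set.encard_univ, ENat.card_eq_coe_fintype_card, Fintype.card_prod, sq]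
  have hall : {p | IsLSP w p} =
      {p | IsLSP w p ∧ 3 ≤ p.length} ∪ {p | IsLSP w p ∧ p.length < 3} := by
    ext p
    simp only [Set.mem_ofPred_eq, Set.mem_union]
    have := le_or_gt 3 p.length
    tauto
  have hsum : numLSP w ≤ ((T.card + Fintype.card V ^ 2 : ℕ) : ℕ∞) := by
    unfold numLSP
    rw [hall, Nat.cast_add]
    exact (Set.encard_union_le _ _).trans (add_le_add hlong hshort)
  calc 2 * numLSP w ≤ 2 * ((T.card + Fintype.card V ^ 2 : ℕ) : ℕ∞) := by gcongr
    _ = ((2 * (T.card + Fintype.card V ^ 2) : ℕ) : ℕ∞) := by push_cast; rfl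
    _ ≤ _ := by
      rw [Nat.cast_le]
      omega

/-- No two edges leaving an explored set are tied. -/
def HasNoTies (w : V → V → ℝ) : Prop :=
  ∀ s h, IsGrowth s h → ∀ i ∈ explored s h, ∀ u ∉ explored s h, ∀ j ∈ explored s h,
    ∀ v ∉ explored s h, (j, v) ≠ (i, u) → arrival w h i + w i u ≠ arrival w h j + w j v

/-- The cheapest edge of the cut is strictly cheapest when there are no ties. Edges leaving the new
vertex then arrive later because weights are positive. -/
lemma HasNoTies.exists_isRun {w : V → V → ℝ} (hties : HasNoTies w)
    (hw : ∀ a b, a ≠ b → 0 < w a b) (s : V) (k : ℕ) (hk : k < Fintype.card V) :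
    ∃ h : List (V × V), h.length = k ∧ IsRun w s h := by
  induction k with
  | zero =>
    refine ⟨[], rfl, trivial, fun j hj v hv => ?_⟩
    simp only [explored, Finset.mem_singleton] at hj hv
    simpa [lastArrival, arrival] using hw j v (by rw [hj]; exact Ne.symm hv)
  | succ k ih =>
    obtain ⟨h, hlen, hrun⟩ := ih (by omega)
    have hg := hrun.1.isGrowth
    have hne : ((explored s h) ×ˢ (explored s h)ᶜ).Nonempty := by
      refine Finset.Nonempty.product ⟨s, source_mem_explored s h⟩ ?_
      rw [← Finset.card_pos, Finset.card_compl, hg.card_explored]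
      omega
    obtain ⟨⟨i, u⟩, hiu, hmin⟩ := Finset.exists_min_image _
      (fun e : V × V => arrival w h e.1 + w e.1 e.2) hne
    simp only [Finset.mem_product, Finset.mem_compl, Prod.forall, and_imp] at hiu hmin
    have hlt : ∀ j ∈ explored s h, ∀ v ∉ explored s h, (j, v) ≠ (i, u) →
        arrival w h i + w i u < arrival w h j + w j v := fun j hj v hv hjv =>
      lt_of_le_of_ne (hmin j v hj hv) (hties s h hg i hiu.1 u hiu.2 j hj v hv hjv)
    refine ⟨(i, u) :: h, by simp [hlen], ⟨hrun.1, hiu.1, hiu.2, hrun.2 i hiu.1 u hiu.2,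
      fun j hj hji => hlt j hj u hiu.2 (by simpa using hji)⟩, ?_⟩
    intro j hj v hv
    simp only [explored, Finset.mem_insert, not_or] at hj hv
    by_cases hju : j = u
    · subst hju
      simpa [arrival, lastArrival] using hw j v (Ne.symm hv.1)
    · have hj' := hj.resolve_left hju
      simpa [arrival, lastArrival, hju] using hlt j hj' v hv.2 (by simp [hv.1])

end Counting

/-! ### The race between conditioned uniform variables. -/

section Race

lemma measurable_lt_prop {α : Type*} [MeasurableSpace α] {f g : α → ℝ} (hf : Measurable f)
    (hg : Measurable g) : Measurable fun x => f x < g x := (measurableSet_lt hf hg).mem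

lemma measurable_le_prop {α : Type*} [MeasurableSpace α] {f g : α → ℝ} (hf : Measurable f)
    (hg : Measurable g) : Measurable fun x => f x ≤ g x := (measurableSet_le hf hg).mem

/-- The uniform distribution on `[0, 1]`. -/
noncomputable abbrev unifMeasure : Measure ℝ := volume.restrict (Set.Icc 0 1)

instance : IsProbabilityMeasure unifMeasure := ⟨by simp⟩

lemma unifMeasure_Ioi {t : ℝ} (ht : 0 ≤ t) : unifMeasure (Set.Ioi t) = ENNReal.ofReal (1 - t) := by
  rw [Measure.restrict_apply measurableSet_Ioi]
  have : Set.Ioi t ∩ Set.Icc 0 1 = Set.Ioc t 1 := by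
    ext r
    simp only [Set.mem_inter_iff, Set.mem_Ioi, Set.mem_Icc, Set.mem_Ioc]
    exact ⟨fun h => ⟨h.1, h.2.2⟩, fun h => ⟨h.1, (ht.trans_lt h.1).le, h.2⟩⟩
  rw [this, Real.volume_Ioc]

lemma lintegral_pow_le {a : ℝ} (ha : 0 ≤ a) (M : ℕ) :
    ∫⁻ r in Set.Ioc a 1, ENNReal.ofReal (1 - (r - a)) ^ M ≤ ENNReal.ofReal (1 / (M + 1)) := by
  rcases le_or_gt a 1 with ha1 | ha1
  swap
  · rw [Set.Ioc_eq_empty (by linarith)]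
    simp
  have h1 : ∀ r ∈ Set.Ioc a 1, ENNReal.ofReal (1 - (r - a)) ^ M =
      ENNReal.ofReal ((1 + a - r) ^ M) := by
    intro r hr
    rw [← ENNReal.ofReal_pow (by linarith [hr.2])]
    congr 2
    ring
  rw [setLIntegral_congr_fun measurableSet_Ioc h1, ← ofReal_integral_eq_lintegral_ofReal]
  · apply ENNReal.ofReal_le_ofReal
    rw [← intervalIntegral.integral_of_le ha1,
      intervalIntegral.integral_comp_sub_left (fun x => x ^ M) (1 + a), integral_pow]
    simp only [add_sub_cancel_right, add_sub_cancel_left, one_pow]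
    gcongr
    have := pow_nonneg ha (M + 1)
    linarith
  · exact (Continuous.integrableOn_Icc (by fun_prop)).mono_set Set.Ioc_subset_Icc_self
  · filter_upwards [ae_restrict_mem measurableSet_Ioc] with r hr
    exact pow_nonneg (by linarith [hr.2]) M

variable {ι : Type*} [DecidableEq ι]

/-- Inclusion is required only on the fibre over `x`, where all coordinates outside `C` are frozen.
-/
lemma lmarginal_indicator_mono {C : Finset ι} {F G : Set (ι → ℝ)} {x : ι → ℝ}
    (hFG : ∀ y, Function.updateFinset x C y ∈ F → Function.updateFinset x C y ∈ G) :
    lmarginal (fun _ : ι => unifMeasure) C (F.indicator fun _ => 1) x ≤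
      lmarginal (fun _ : ι => unifMeasure) C (G.indicator fun _ => 1) x := by
  classical
  refine lintegral_mono fun y => ?_
  simp only [Set.indicator_apply]
  split_ifs with h1 h2 h2
  · rfl
  · exact absurd (hFG y h1) h2
  · exact zero_le
  · rfl

lemma lmarginal_orthant (C : Finset ι) (t : ι → ℝ) (ht : ∀ e ∈ C, 0 ≤ t e) (x : ι → ℝ) :
    lmarginal (fun _ : ι => unifMeasure) C
      (Set.indicator {y | ∀ e ∈ C, t e < y e} (fun _ => 1)) x =
      ∏ e ∈ C, ENNReal.ofReal (1 - t e) := by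
  unfold lmarginal
  have h1 : ∀ y : (C → ℝ), Set.indicator {y | ∀ e ∈ C, t e < y e} (fun _ => (1 : ENNReal))
      (Function.updateFinset x C y) =
      Set.indicator (Set.univ.pi fun e : C => Set.Ioi (t e)) (fun _ => 1) y := by
    intro y
    simp only [Set.indicator_apply]
    congr 1
    simp +contextual [Function.updateFinset]
  simp_rw [h1]
  rw [lintegral_indicator (MeasurableSet.univ_pi fun _ => measurableSet_Ioi)]
  simp only [lintegral_const, one_mul, Measure.restrict_apply_univ, Measure.pi_pi]
  rw [← Finset.prod_coe_sort C fun e => ENNReal.ofReal (1 - t e)]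
  exact Finset.prod_congr rfl fun e _ => unifMeasure_Ioi (ht e e.2)

/-- Among independent uniform variables, conditioned to exceed given thresholds of size at most
`1/2`, each has probability at most `2/N` to have the least excess. -/
lemma lmarginal_race_le [Fintype ι] (C : Finset ι) (a : ι → ℝ) (ha0 : ∀ e ∈ C, 0 ≤ a e)
    (ha1 : ∀ e ∈ C, a e ≤ 1 / 2) {e₀ : ι} (he₀ : e₀ ∈ C) (x : ι → ℝ) :
    lmarginal (fun _ : ι => unifMeasure) C (Set.indicator
      {y | a e₀ < y e₀ ∧ ∀ e ∈ C, e ≠ e₀ → y e₀ - a e₀ < y e - a e} (fun _ => 1)) x ≤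
    ENNReal.ofReal (2 / C.card) * lmarginal (fun _ : ι => unifMeasure) C
      (Set.indicator {y | ∀ e ∈ C, a e < y e} (fun _ => 1)) x := by
  set R : Set (ι → ℝ) := {y | a e₀ < y e₀ ∧ ∀ e ∈ C, e ≠ e₀ → y e₀ - a e₀ < y e - a e} with hR
  have hRm : MeasurableSet R := by
    refine Measurable.setOf (Measurable.and ?_ ?_)
    · exact measurable_lt_prop measurable_const (measurable_pi_apply _)
    · refine Measurable.forall fun e => Measurable.imp measurable_const
        (Measurable.imp measurable_const ?_)
      exact measurable_lt_prop (by fun_prop) (by fun_prop)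
  have hcard : ((C.erase e₀).card : ℝ) + 1 = C.card := by
    exact_mod_cast Finset.card_erase_add_one he₀
  set K : ENNReal := ∏ e ∈ C.erase e₀, ENNReal.ofReal (1 - a e) with hK
  -- Fix the winning coordinate at `r`. With u = r - a e₀, every other coordinate must exceed a e +
  -- u, and 1 - a - u ≤ (1 - a)(1 - u) separates the thresholds from the race.
  have hinner : ∀ r, r ∈ Set.Icc (0 : ℝ) 1 →
      lmarginal (fun _ : ι => unifMeasure) (C.erase e₀) (Set.indicator R (fun _ => 1))
        (Function.update x e₀ r) ≤
      (Set.Ioc (a e₀) 1).indicator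
        (fun r => K * ENNReal.ofReal (1 - (r - a e₀)) ^ (C.erase e₀).card) r := by
    intro r hr
    have hval : ∀ y, Function.updateFinset (Function.update x e₀ r) (C.erase e₀) y e₀ = r := by
      intro y
      simp [Function.updateFinset]
    by_cases hra : a e₀ < r
    · rw [Set.indicator_of_mem (show r ∈ Set.Ioc (a e₀) 1 from ⟨hra, hr.2⟩)]
      have hstep : lmarginal (fun _ : ι => unifMeasure) (C.erase e₀)
          (Set.indicator R (fun _ => 1)) (Function.update x e₀ r) ≤
          lmarginal (fun _ : ι => unifMeasure) (C.erase e₀)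
          (Set.indicator {y | ∀ e ∈ C.erase e₀, a e + (r - a e₀) < y e} (fun _ => 1))
            (Function.update x e₀ r) := by
        refine lmarginal_indicator_mono fun y hy e he => ?_
        have := hy.2 e (Finset.mem_of_mem_erase he) (Finset.ne_of_mem_erase he)
        rw [hval] at this
        linarith
      refine hstep.trans ?_
      rw [lmarginal_orthant _ _ fun e he => by
        linarith [ha0 e (Finset.mem_of_mem_erase he)], hK, ← Finset.prod_const,
        ← Finset.prod_mul_distrib]
      refine Finset.prod_le_prod' fun e he => ?_
      have h0 := ha0 e (Finset.mem_of_mem_erase he)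
      have h1 := ha1 e (Finset.mem_of_mem_erase he)
      rw [← ENNReal.ofReal_mul (by linarith)]
      apply ENNReal.ofReal_le_ofReal
      nlinarith [mul_nonneg h0 (sub_nonneg.2 hra.le)]
    · have : lmarginal (fun _ : ι => unifMeasure) (C.erase e₀)
          (Set.indicator R (fun _ => 1)) (Function.update x e₀ r) = 0 := by
        unfold lmarginal
        rw [lintegral_eq_zero_of_ae_eq_zero]
        refine Filter.Eventually.of_forall fun y => ?_
        refine Set.indicator_of_notMem (fun hy => hra ?_) _
        have := hy.1
        rwa [hval] at this
      rw [this]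
      exact zero_le
  have hmeas : Measurable fun r : ℝ => ENNReal.ofReal (1 - (r - a e₀)) ^ (C.erase e₀).card := by
    fun_prop
  -- The winner's own factor 1 - a e₀ is missing from `K`; restoring it costs at most 2 because
  -- thresholds are at most 1/2.
  have hKC : K ≤ 2 * ∏ e ∈ C, ENNReal.ofReal (1 - a e) := by
    rw [← Finset.mul_prod_erase C _ he₀, ← hK, ← mul_assoc]
    have h2 : (1 : ENNReal) ≤ 2 * ENNReal.ofReal (1 - a e₀) := by
      rw [show (2 : ENNReal) = ENNReal.ofReal 2 by simp, ← ENNReal.ofReal_mul (by norm_num),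
        ← ENNReal.ofReal_one]
      apply ENNReal.ofReal_le_ofReal
      linarith [ha1 e₀ he₀]
    calc K = 1 * K := (one_mul K).symm
      _ ≤ _ := by gcongr
  rw [lmarginal_erase _ (measurable_const.indicator hRm) he₀, lmarginal_orthant _ _ ha0]
  calc ∫⁻ r in Set.Icc (0 : ℝ) 1, lmarginal (fun _ : ι => unifMeasure) (C.erase e₀)
        (Set.indicator R (fun _ => 1)) (Function.update x e₀ r)
      ≤ ∫⁻ r in Set.Icc (0 : ℝ) 1, (Set.Ioc (a e₀) 1).indicator
        (fun r => K * ENNReal.ofReal (1 - (r - a e₀)) ^ (C.erase e₀).card) r :=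
        setLIntegral_mono' measurableSet_Icc hinner
    _ ≤ ∫⁻ r, (Set.Ioc (a e₀) 1).indicator
        (fun r => K * ENNReal.ofReal (1 - (r - a e₀)) ^ (C.erase e₀).card) r :=
        setLIntegral_le_lintegral _ _
    _ = K * ∫⁻ r in Set.Ioc (a e₀) 1, ENNReal.ofReal (1 - (r - a e₀)) ^ (C.erase e₀).card := by
        rw [lintegral_indicator measurableSet_Ioc, lintegral_const_mul _ hmeas]
    _ ≤ (2 * ∏ e ∈ C, ENNReal.ofReal (1 - a e)) * ENNReal.ofReal (1 / C.card) := by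
        rw [← hcard]
        exact mul_le_mul' hKC (lintegral_pow_le (ha0 e₀ he₀) _)
    _ = _ := by
        rw [div_eq_mul_one_div (2 : ℝ), ENNReal.ofReal_mul (by norm_num)]
        simp only [ENNReal.ofReal_ofNat]
        ring

end Race

/-! ### Conditional law of the next tree edge, and almost sure regularity. -/

section Runs

variable (V : Type*)

/-- The edges of the complete directed graph. -/
abbrev Edge := {e : V × V // e.1 ≠ e.2}

variable {V} [DecidableEq V]

/-- The weight function with given values on the edges, and zero on the diagonal. -/
def weight (x : Edge V → ℝ) (a b : V) : ℝ := if h : a ≠ b then x ⟨(a, b), h⟩ else 0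

lemma weight_of_ne (x : Edge V → ℝ) {a b : V} (h : a ≠ b) : weight x a b = x ⟨(a, b), h⟩ :=
  dif_pos h

/-- The event that the algorithm follows a history and that no arrival is later than `1/2`. -/
def runSet (s : V) (h : List (V × V)) : Set (Edge V → ℝ) :=
  {x | IsRun (weight x) s h ∧ lastArrival (weight x) h ≤ 1 / 2}

lemma arrival_congr {w w' : V → V → ℝ} {s : V} {h : List (V × V)} (H : IsGrowth s h)
    (hw : ∀ a ∈ explored s h, ∀ b ∈ explored s h, a ≠ b → w a b = w' a b) :
    arrival w h = arrival w' h ∧ lastArrival w h = lastArrival w' h ∧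
      (IsInner w s h ↔ IsInner w' s h) := by
  induction h with
  | nil => exact ⟨rfl, rfl, Iff.rfl⟩
  | cons e h ih =>
    obtain ⟨hg, h1, h2⟩ := H
    obtain ⟨i1, i2, i3⟩ := ih hg fun a ha b hb => hw a (Finset.mem_insert_of_mem ha) b
      (Finset.mem_insert_of_mem hb)
    have hnew : ∀ j ∈ explored s h, w j e.2 = w' j e.2 := fun j hj =>
      hw j (Finset.mem_insert_of_mem hj) e.2 (Finset.mem_insert_self _ _)
        fun hje => h2 (hje ▸ hj)
    refine ⟨by simp only [arrival, i1, hnew e.1 h1], by simp only [lastArrival, i1, hnew e.1 h1],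
      ?_⟩
    simp only [IsInner, i1, i2, i3, hnew e.1 h1]
    refine and_congr_right fun _ => and_congr_right fun _ => and_congr_right fun _ =>
      and_congr_right fun _ => forall₂_congr fun j hj => ?_
    rw [hnew j hj]

@[fun_prop]
lemma measurable_weight (a b : V) : Measurable fun x : Edge V → ℝ => weight x a b := by
  unfold weight
  split_ifs <;> fun_prop

@[fun_prop]
lemma measurable_arrival (h : List (V × V)) (v : V) :
    Measurable fun x : Edge V → ℝ => arrival (weight x) h v := by
  induction h generalizing v with
  | nil => exact measurable_const
  | cons e h ih =>
    by_cases hv : v = e.2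
    · subst hv
      simp only [arrival, Function.update_self]
      exact (ih e.1).add (measurable_weight _ _)
    · simpa only [arrival, ne_eq, hv, not_false_eq_true, Function.update_of_ne] using ih v

@[fun_prop]
lemma measurable_lastArrival (h : List (V × V)) :
    Measurable fun x : Edge V → ℝ => lastArrival (weight x) h := by
  cases h with
  | nil => exact measurable_const
  | cons e h => exact (measurable_arrival h e.1).add (measurable_weight _ _)

lemma measurable_isInner [Countable V] (s : V) (h : List (V × V)) :
    Measurable fun x : Edge V → ℝ => IsInner (weight x) s h := by
  induction h with
  | nil => exact measurable_const
  | cons e h ih =>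
    refine ih.and (measurable_const.and (measurable_const.and (Measurable.and ?_ ?_)))
    · exact measurable_lt_prop (by fun_prop) (by fun_prop)
    · refine Measurable.forall fun j => Measurable.imp measurable_const
        (Measurable.imp measurable_const ?_)
      exact measurable_lt_prop (by fun_prop) (by fun_prop)

lemma measurableSet_runSet [Countable V] (s : V) (h : List (V × V)) :
    MeasurableSet (runSet s h) := by
  refine Measurable.setOf (Measurable.and (Measurable.and (measurable_isInner s h) ?_) ?_)
  · refine Measurable.forall fun j => Measurable.imp measurable_const (Measurable.forall fun v =>
      Measurable.imp measurable_const ?_)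
    exact measurable_lt_prop (by fun_prop) (by fun_prop)
  · exact measurable_le_prop (by fun_prop) (by fun_prop)

/-- The edges leaving a set of vertices. -/
def cut [Fintype V] (A : Finset V) : Finset (Edge V) := {e | e.1.1 ∈ A ∧ e.1.2 ∉ A}

lemma card_cut [Fintype V] (A : Finset V) :
    (cut A).card = A.card * (Fintype.card V - A.card) := by
  rw [← Finset.card_compl, ← Finset.card_product]
  refine Finset.card_bij (fun e _ => e.1) (fun e he => ?_) (fun e _ f _ h => Subtype.ext h)
    fun b hb => ?_
  · simpa [cut] using he
  · simp only [Finset.mem_product, Finset.mem_compl] at hb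
    exact ⟨⟨b, fun h => hb.2 (h ▸ hb.1)⟩, by simpa [cut] using hb, rfl⟩

/-- The law of independent uniform edge weights. -/
noncomputable abbrev edgeMeasure (V : Type*) [Fintype V] [DecidableEq V] :
    Measure (Edge V → ℝ) :=
  Measure.pi fun _ => unifMeasure

variable [Fintype V]

/-- This replaces conditional probability: a comparison that holds for every frozen configuration
outside `C` integrates to one of measures. -/
lemma edgeMeasure_le_of_lmarginal {F G : Set (Edge V → ℝ)} (hF : MeasurableSet F)
    (hG : MeasurableSet G) (C : Finset (Edge V)) {c : ENNReal} (hc : c ≠ ⊤)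
    (hFG : ∀ x, lmarginal (fun _ => unifMeasure) C (F.indicator fun _ => 1) x ≤
      c * lmarginal (fun _ => unifMeasure) C (G.indicator fun _ => 1) x) :
    edgeMeasure V F ≤ c * edgeMeasure V G := by
  have h1 := lintegral_le_of_lmarginal_le (μ := fun _ : Edge V => unifMeasure) C
    (f := F.indicator fun _ => 1) (g := fun x => c * G.indicator (fun _ => 1) x)
    (measurable_const.indicator hF) ((measurable_const.indicator hG).const_mul c) (fun x => by
      refine (hFG x).trans (le_of_eq ?_)
      unfold lmarginal
      rw [lintegral_const_mul' _ _ hc])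
  rwa [lintegral_const_mul' _ _ hc, lintegral_indicator hF, lintegral_indicator hG,
    setLIntegral_const, setLIntegral_const, one_mul, one_mul] at h1

/-- Each edge leaving the explored set is the next tree edge with conditional probability at most
`2/N`, where `N` is the number of such edges. -/
lemma edgeMeasure_runSet_cons_le (s : V) (e : V × V) (h : List (V × V)) :
    edgeMeasure V (runSet s (e :: h)) ≤
      ENNReal.ofReal (2 / (cut (explored s h)).card) * edgeMeasure V (runSet s h) := by
  by_cases hg : IsGrowth s h ∧ e.1 ∈ explored s h ∧ e.2 ∉ explored s h
  swap
  · have : runSet s (e :: h) = ∅ := by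
      ext x
      refine iff_of_false (fun hx => hg ?_) (Set.notMem_empty x)
      have := hx.1.1
      exact ⟨this.1.isGrowth, this.2.1, this.2.2.1⟩
    rw [this, measure_empty]
    exact zero_le
  obtain ⟨hg, h1, h2⟩ := hg
  have hne : e.1 ≠ e.2 := fun h12 => h2 (h12 ▸ h1)
  have he₀ : (⟨e, hne⟩ : Edge V) ∈ cut (explored s h) := by simp [cut, h1, h2]
  refine edgeMeasure_le_of_lmarginal (measurableSet_runSet _ _) (measurableSet_runSet _ _)
    (cut (explored s h)) ENNReal.ofReal_ne_top fun x => ?_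
  -- Cut edges end outside the explored set, so resampling them leaves the inner part of the history
  -- unchanged.
  have hupd : ∀ y, arrival (weight (Function.updateFinset x (cut (explored s h)) y)) h =
      arrival (weight x) h ∧ lastArrival (weight (Function.updateFinset x (cut (explored s h)) y)) h
      = lastArrival (weight x) h ∧
      (IsInner (weight (Function.updateFinset x (cut (explored s h)) y)) s h ↔
        IsInner (weight x) s h) := by
    refine fun y => arrival_congr hg fun a _ b hb hab => ?_
    rw [weight_of_ne _ hab, weight_of_ne _ hab, Function.updateFinset, dif_neg]
    simp [cut, hb]
  by_cases hx : IsInner (weight x) s h ∧ lastArrival (weight x) h ≤ 1 / 2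
  swap
  · have : lmarginal (fun _ => unifMeasure) (cut (explored s h))
        ((runSet s (e :: h)).indicator fun _ => 1) x = 0 := by
      unfold lmarginal
      rw [lintegral_eq_zero_of_ae_eq_zero]
      refine Filter.Eventually.of_forall fun y => Set.indicator_of_notMem (fun hy => hx ?_) _
      obtain ⟨hi, hl⟩ := hy
      obtain ⟨hi, -, -, hlt, -⟩ := hi.of_cons
      rw [← (hupd y).2.1, ← (hupd y).2.2]
      exact ⟨hi.1, hlt.le.trans hl⟩
    rw [this]
    exact zero_le
  -- The history reveals about a cut edge exactly that its weight exceeds this threshold; the excess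
  -- is its waiting time after the last arrival.
  set a : Edge V → ℝ := fun f => lastArrival (weight x) h - arrival (weight x) h f.1.1 with ha
  have ha0 : ∀ f ∈ cut (explored s h), 0 ≤ a f := fun f hf => by
    have := (hx.1.arrival_le (j := f.1.1) (by simpa [cut] using (Finset.mem_filter.1 hf).2.1)).2
    simpa [ha] using this
  have ha1 : ∀ f ∈ cut (explored s h), a f ≤ 1 / 2 := fun f hf => by
    have := (hx.1.arrival_le (j := f.1.1) (by simpa [cut] using (Finset.mem_filter.1 hf).2.1)).1
    simp only [ha]
    linarith [hx.2]
  refine le_trans (lmarginal_indicator_mono fun y hy => ?_)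
    ((lmarginal_race_le _ a ha0 ha1 he₀ x).trans ?_)
  · obtain ⟨hrun, -, -, hlt, hmin⟩ := hy.1.of_cons
    simp only [lastArrival, (hupd y).1] at hlt hmin
    rw [← lastArrival.eq_def, (hupd y).2.1, weight_of_ne _ hne] at hlt
    refine ⟨by simp only [ha]; linarith, fun f hf hfe => ?_⟩
    obtain ⟨-, hf1, hf2⟩ := Finset.mem_filter.1 hf
    have := hmin f.1.1 hf1 f.1.2 hf2 fun h' => hfe (Subtype.ext h')
    rw [weight_of_ne _ hne, weight_of_ne _ f.2] at this
    simp only [ha]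
    linarith
  · gcongr
    refine lmarginal_indicator_mono fun y hy => ?_
    refine ⟨⟨(hupd y).2.2.2 hx.1, fun j hj v hv => ?_⟩, (hupd y).2.1.le.trans hx.2⟩
    have hjv : j ≠ v := fun h' => hv (h' ▸ hj)
    have := hy ⟨(j, v), hjv⟩ (by simp [cut, hj, hv])
    simp only [ha] at this
    rw [(hupd y).1, (hupd y).2.1, weight_of_ne _ hjv]
    linarith

lemma edgeMeasure_eq_zero (e : Edge V) {f : (Edge V → ℝ) → ℝ} (hf : Measurable f)
    (hfe : ∀ x r, f (Function.update x e r) = f x) : edgeMeasure V {x | x e = f x} = 0 := by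
  have hm : MeasurableSet {x : Edge V → ℝ | x e = f x} :=
    measurableSet_eq_fun (measurable_pi_apply e) hf
  have := edgeMeasure_le_of_lmarginal hm MeasurableSet.empty {e} ENNReal.zero_ne_top
    (fun x => ?_)
  · simpa using this
  rw [lmarginal_singleton, zero_mul]
  have : ∀ r, Set.indicator {x : Edge V → ℝ | x e = f x} (fun _ => (1 : ENNReal))
      (Function.update x e r) = Set.indicator {f x} (fun _ => 1) r := by
    intro r
    simp only [Set.indicator_apply]
    congr 1
    simp [hfe]
  simp_rw [this]
  rw [lintegral_indicator (measurableSet_singleton _)]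
  simp

/-- There are countably many histories, and a tie fixes the weight of `(i, u)` in terms of other
weights: `u` is unexplored, so no arrival time of the history involves this edge. -/
lemma ae_hasNoTies : ∀ᵐ x ∂edgeMeasure V, HasNoTies (weight x) := by
  unfold HasNoTies
  simp only [ae_all_iff]
  intro s h hg i hi u hu j hj v hv hne
  have hiu : i ≠ u := fun h' => hu (h' ▸ hi)
  have hjv : j ≠ v := fun h' => hv (h' ▸ hj)
  have hz := edgeMeasure_eq_zero (V := V) ⟨(i, u), hiu⟩
    (f := fun x => arrival (weight x) h j + weight x j v - arrival (weight x) h i)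
    (by fun_prop) (fun x r => by
      have : arrival (weight (Function.update x ⟨(i, u), hiu⟩ r)) h = arrival (weight x) h := by
        refine (arrival_congr hg fun a _ b hb hab => ?_).1
        rw [weight_of_ne _ hab, weight_of_ne _ hab, Function.update_of_ne]
        intro h'
        have hbu : b = u := congrArg (fun e : Edge V => e.1.2) h'
        exact hu (hbu ▸ hb)
      simp only [this]
      rw [weight_of_ne _ hjv, weight_of_ne _ hjv, Function.update_of_ne]
      exact fun h' => hne (congrArg Subtype.val h'))
  filter_upwards [compl_mem_ae_iff.2 hz] with x hx h'
  refine hx ?_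
  rw [weight_of_ne x hiu] at h'
  change x _ = _
  linarith

lemma ae_weight_pos : ∀ᵐ x ∂edgeMeasure V, ∀ a b, a ≠ b → 0 < weight x a b := by
  simp only [ae_all_iff]
  intro a b hab
  have h1 : ∀ᵐ r ∂unifMeasure, 0 < r := by
    have h2 : ∀ᵐ r : ℝ, r ≠ 0 := by simp [ae_iff]
    filter_upwards [ae_restrict_mem measurableSet_Icc, ae_restrict_of_ae h2] with r hr hr0
    exact lt_of_le_of_ne hr.1 (Ne.symm hr0)
  have h3 := (measurePreserving_eval (fun _ : Edge V => unifMeasure) ⟨(a, b), hab⟩)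
  filter_upwards [h3.quasiMeasurePreserving.ae h1] with x hx
  rwa [weight_of_ne _ hab]

end Runs

/-! ### First and second moments of the sum of squared child counts. -/

section Moments

/-- The lists of pairs of a given length. -/
def histories (V : Type*) [Fintype V] [DecidableEq V] : ℕ → Finset (List (V × V))
  | 0 => {[]}
  | k + 1 => (Finset.univ ×ˢ histories V k).image fun p => p.1 :: p.2

variable {V : Type*} [Fintype V] [DecidableEq V]

lemma mem_histories {k : ℕ} {h : List (V × V)} : h ∈ histories V k ↔ h.length = k := by
  induction k generalizing h with
  | zero => simp [histories]
  | succ k ih => cases h <;> simp [histories, ih]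

lemma sum_histories_succ (k : ℕ) (f : List (V × V) → ℝ) :
    ∑ h ∈ histories V (k + 1), f h = ∑ h ∈ histories V k, ∑ e : V × V, f (e :: h) := by
  rw [histories, Finset.sum_image (by rintro ⟨a, b⟩ - ⟨c, d⟩ - h; simpa using h),
    Finset.sum_product_right]

/-- The probability of following a history, with all arrivals before time `1/2`. -/
noncomputable def runProb (s : V) (h : List (V × V)) : ℝ := (edgeMeasure V).real (runSet s h)

variable (s : V)

lemma runProb_nonneg (h : List (V × V)) : 0 ≤ runProb s h := measureReal_nonneg

variable {s}

lemma runProb_eq_zero {h : List (V × V)} (hg : ¬ IsGrowth s h) : runProb s h = 0 := by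
  have : runSet s h = ∅ := by
    ext x
    exact iff_of_false (fun hx => hg hx.1.1.isGrowth) (Set.notMem_empty x)
  simp [runProb, this]

variable (s)

/-- Distinct next steps are disjoint events, as each would be the strict minimizer. Mass may be lost
because arrivals after time 1/2 are discarded. -/
lemma sum_runProb_cons_le (h : List (V × V)) : ∑ e, runProb s (e :: h) ≤ runProb s h := by
  unfold runProb
  rw [← measureReal_biUnion_finset]
  · refine measureReal_mono (Set.iUnion₂_subset fun e _ x hx => ?_)
    obtain ⟨h1, -, -, h2, -⟩ := hx.1.of_cons
    exact ⟨h1, h2.le.trans hx.2⟩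
  · intro e _ f _ hef
    refine Set.disjoint_left.2 fun x hx hx' => ?_
    obtain ⟨-, h1, h2, -, h3⟩ := hx.1.of_cons
    obtain ⟨-, h1', h2', -, h3'⟩ := hx'.1.of_cons
    exact lt_asymm (h3 f.1 h1' f.2 h2' hef.symm) (h3' e.1 h1 e.2 h2 hef)
  · exact fun e _ => measurableSet_runSet s _

lemma runProb_cons_le (e : V × V) (h : List (V × V)) :
    runProb s (e :: h) ≤ 2 / (cut (explored s h)).card * runProb s h := by
  have h1 := ENNReal.toReal_mono (ENNReal.mul_ne_top ENNReal.ofReal_ne_top (measure_ne_top _ _))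
    (edgeMeasure_runSet_cons_le s e h)
  rwa [ENNReal.toReal_mul, ENNReal.toReal_ofReal (by positivity)] at h1

/-- Summing the edge bound over the unexplored endpoints cancels their number against the size of
the cut, leaving twice the uniform law on the explored vertices. -/
lemma sum_runProb_cons_mul_le (h : List (V × V)) {ψ : V → ℝ} (hψ : ∀ i, 0 ≤ ψ i) :
    ∑ e, runProb s (e :: h) * ψ e.1 ≤
      runProb s h * (2 / (h.length + 1) * ∑ i ∈ explored s h, ψ i) := by
  by_cases hg : IsGrowth s h
  swap
  · simp [runProb_eq_zero hg, runProb_eq_zero fun hg' : IsGrowth s (_ :: h) => hg hg'.1]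
  have hcard := hg.card_explored
  set A := explored s h
  have hsum : ∑ e, runProb s (e :: h) * ψ e.1 =
      ∑ e ∈ A ×ˢ Aᶜ, runProb s (e :: h) * ψ e.1 := by
    refine (Finset.sum_subset (Finset.subset_univ _) fun e _ he => ?_).symm
    rw [runProb_eq_zero, zero_mul]
    intro hg'
    exact he (by simpa using ⟨hg'.2.1, hg'.2.2⟩)
  rw [hsum, Finset.sum_product]
  have hc : (cut A).card = (h.length + 1) * Aᶜ.card := by
    rw [card_cut, hcard, Finset.card_compl, hcard]
  calc ∑ i ∈ A, ∑ u ∈ Aᶜ, runProb s ((i, u) :: h) * ψ i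
      ≤ ∑ i ∈ A, ∑ u ∈ Aᶜ, 2 / (cut A).card * runProb s h * ψ i := by
        gcongr with i hi u hu
        · exact hψ i
        · exact runProb_cons_le s (i, u) h
    _ = (Aᶜ.card * (2 / (cut A).card)) * (runProb s h * ∑ i ∈ A, ψ i) := by
        simp only [Finset.sum_const, nsmul_eq_mul, Finset.mul_sum]
        refine Finset.sum_congr rfl fun i _ => ?_
        ring
    _ ≤ (2 / (h.length + 1)) * (runProb s h * ∑ i ∈ A, ψ i) := by
        have := Finset.sum_nonneg fun i (_ : i ∈ A) => hψ i
        have := runProb_nonneg s h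
        gcongr
        rw [hc]
        push_cast
        rcases Nat.eq_zero_or_pos Aᶜ.card with h0 | h0
        · rw [h0]
          simp only [CharP.cast_eq_zero, zero_mul]
          positivity
        · have : (0 : ℝ) < Aᶜ.card := by exact_mod_cast h0
          refine le_of_eq ?_
          field_simp
    _ = _ := by ring

lemma sum_runProb_le_one (k : ℕ) : ∑ h ∈ histories V k, runProb s h ≤ 1 := by
  induction k with
  | zero => simp [histories, runProb]
  | succ k ih =>
    rw [sum_histories_succ]
    exact (Finset.sum_le_sum fun h _ => sum_runProb_cons_le s h).trans ih

lemma sum_explored_childCount_le (h : List (V × V)) :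
    (∑ i ∈ explored s h, (childCount h i : ℝ)) ≤ h.length := by
  rw [← sum_childCount h]
  push_cast
  exact Finset.sum_le_univ_sum_of_nonneg fun i => by positivity

/-- With k steps made there are k children in all and k + 1 explored vertices, so the mean increment
is at most 2(2k + k + 1)/(k + 1) ≤ 6. -/
lemma sum_explored_increment_le {h : List (V × V)} (hg : IsGrowth s h) :
    2 / ((h.length : ℝ) + 1) * ∑ i ∈ explored s h, (2 * (childCount h i : ℝ) + 1) ≤ 6 := by
  rw [div_mul_eq_mul_div, div_le_iff₀ (by positivity), Finset.sum_add_distrib, ← Finset.mul_sum,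
    Finset.sum_const, hg.card_explored]
  have := sum_explored_childCount_le s h
  simp only [nsmul_eq_mul, Nat.cast_add, Nat.cast_one, mul_one]
  linarith

lemma sum_explored_increment_sq_le {h : List (V × V)} (hg : IsGrowth s h) :
    2 / ((h.length : ℝ) + 1) * ∑ i ∈ explored s h, (2 * (childCount h i : ℝ) + 1) ^ 2 ≤
      8 / (h.length + 1) * sqChildCount h + 10 := by
  have h1 := sum_explored_childCount_le s h
  have h2 : (∑ i ∈ explored s h, (childCount h i : ℝ) ^ 2) ≤ sqChildCount h := by
    rw [sqChildCount]
    push_cast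
    exact Finset.sum_le_univ_sum_of_nonneg fun i => by positivity
  have h3 : ∑ i ∈ explored s h, (2 * (childCount h i : ℝ) + 1) ^ 2 =
      4 * ∑ i ∈ explored s h, (childCount h i : ℝ) ^ 2 +
        4 * ∑ i ∈ explored s h, (childCount h i : ℝ) + (h.length + 1) := by
    rw [Finset.mul_sum, Finset.mul_sum, ← Finset.sum_add_distrib]
    have : ((h.length : ℝ) + 1) = ∑ i ∈ explored s h, (1 : ℝ) := by
      rw [Finset.sum_const, hg.card_explored]
      simp
    rw [this, ← Finset.sum_add_distrib]
    exact Finset.sum_congr rfl fun i _ => by ring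
  rw [h3, div_mul_eq_mul_div, div_mul_eq_mul_div, div_add' _ _ _ (by positivity)]
  gcongr
  linarith

lemma sum_runProb_mul_sqChildCount_le (k : ℕ) :
    ∑ h ∈ histories V k, runProb s h * sqChildCount h ≤ 6 * k := by
  induction k with
  | zero => simp [histories, sqChildCount, childCount]
  | succ k ih =>
    rw [sum_histories_succ]
    have hstep : ∀ h ∈ histories V k, ∑ e, runProb s (e :: h) * sqChildCount (e :: h) ≤
        runProb s h * sqChildCount h + 6 * runProb s h := by
      intro h hh
      by_cases hg : IsGrowth s h
      swap
      · simp [runProb_eq_zero hg, runProb_eq_zero fun hg' : IsGrowth s (_ :: h) => hg hg'.1]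
      have h1 := sum_runProb_cons_mul_le s h (ψ := fun i => 2 * (childCount h i : ℝ) + 1)
        fun i => by positivity
      have h2 := mul_le_mul_of_nonneg_left (sum_explored_increment_le s hg) (runProb_nonneg s h)
      have h3 := mul_le_mul_of_nonneg_right (sum_runProb_cons_le s h)
        (Nat.cast_nonneg (α := ℝ) (sqChildCount h))
      simp only [sqChildCount_cons, Nat.cast_add, Nat.cast_mul, Nat.cast_ofNat, Nat.cast_one]
      simp only [mul_add (runProb s _) (sqChildCount h : ℝ), Finset.sum_add_distrib]
      rw [← Finset.sum_mul]
      linarith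
    have hone := sum_runProb_le_one s k
    calc _ ≤ ∑ h ∈ histories V k, (runProb s h * sqChildCount h + 6 * runProb s h) :=
          Finset.sum_le_sum hstep
      _ ≤ _ := by
        rw [Finset.sum_add_distrib, ← Finset.mul_sum]
        push_cast
        linarith

lemma sum_runProb_mul_excess_sq_le (k : ℕ) :
    ∑ h ∈ histories V k, runProb s h * ((sqChildCount h - 6 * k : ℕ) : ℝ) ^ 2 ≤ 58 * k := by
  induction k with
  | zero => simp [histories, sqChildCount, childCount]
  | succ k ih =>
    rw [sum_histories_succ]
    have hstep : ∀ h ∈ histories V k,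
        ∑ e, runProb s (e :: h) * ((sqChildCount (e :: h) - 6 * (k + 1) : ℕ) : ℝ) ^ 2 ≤
        runProb s h * ((sqChildCount h - 6 * k : ℕ) : ℝ) ^ 2 +
          (8 / (k + 1) * (runProb s h * sqChildCount h) + 10 * runProb s h) := by
      intro h hh
      by_cases hg : IsGrowth s h
      swap
      · simp [runProb_eq_zero hg, runProb_eq_zero fun hg' : IsGrowth s (_ :: h) => hg hg'.1]
      have hlen := mem_histories.1 hh
      -- Truncated subtraction takes positive parts. With Z the old excess, z = (Z - 6)⁺ and z² +
      -- 12z ≤ Z², so removing the drift pays for the cross term of mean at most 12z.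
      set z : ℕ := sqChildCount h - 6 * k - 6 with hz
      have hzx : (z : ℝ) ^ 2 + 12 * z ≤ ((sqChildCount h - 6 * k : ℕ) : ℝ) ^ 2 := by
        rcases Nat.lt_or_ge (sqChildCount h - 6 * k) 6 with h6 | h6
        · have : z = 0 := by omega
          rw [this]
          have h0 := sq_nonneg ((sqChildCount h - 6 * k : ℕ) : ℝ)
          simp only [CharP.cast_eq_zero]
          linarith
        · have : sqChildCount h - 6 * k = z + 6 := by omega
          rw [this]
          push_cast
          nlinarith
      have hexc : ∀ e, ((sqChildCount (e :: h) - 6 * (k + 1) : ℕ) : ℝ) ^ 2 ≤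
          (z : ℝ) ^ 2 + 2 * z * (2 * (childCount h e.1 : ℝ) + 1) +
            (2 * (childCount h e.1 : ℝ) + 1) ^ 2 := by
        intro e
        have : sqChildCount (e :: h) - 6 * (k + 1) ≤ z + (2 * childCount h e.1 + 1) := by
          rw [sqChildCount_cons]
          omega
        calc ((sqChildCount (e :: h) - 6 * (k + 1) : ℕ) : ℝ) ^ 2
            ≤ ((z + (2 * childCount h e.1 + 1) : ℕ) : ℝ) ^ 2 := by gcongr
          _ = _ := by
            push_cast
            ring
      have h1 := sum_runProb_cons_mul_le s h (ψ := fun i => 2 * (childCount h i : ℝ) + 1)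
        fun i => by positivity
      have h1' := h1.trans (mul_le_mul_of_nonneg_left (sum_explored_increment_le s hg)
        (runProb_nonneg s h))
      have h2 := sum_runProb_cons_mul_le s h (ψ := fun i => (2 * (childCount h i : ℝ) + 1) ^ 2)
        fun i => by positivity
      have h2' := h2.trans (mul_le_mul_of_nonneg_left (sum_explored_increment_sq_le s hg)
        (runProb_nonneg s h))
      rw [hlen] at h2'
      have h3 := mul_le_mul_of_nonneg_right (sum_runProb_cons_le s h) (sq_nonneg (z : ℝ))
      calc ∑ e, runProb s (e :: h) * ((sqChildCount (e :: h) - 6 * (k + 1) : ℕ) : ℝ) ^ 2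
          ≤ ∑ e, runProb s (e :: h) * ((z : ℝ) ^ 2 + 2 * z * (2 * (childCount h e.1 : ℝ) + 1) +
            (2 * (childCount h e.1 : ℝ) + 1) ^ 2) := by
            gcongr with e
            · exact runProb_nonneg s _
            · exact hexc e
        _ = (∑ e, runProb s (e :: h)) * (z : ℝ) ^ 2 +
            2 * z * (∑ e, runProb s (e :: h) * (2 * (childCount h e.1 : ℝ) + 1)) +
            ∑ e, runProb s (e :: h) * (2 * (childCount h e.1 : ℝ) + 1) ^ 2 := by
            rw [Finset.sum_mul, Finset.mul_sum, ← Finset.sum_add_distrib, ← Finset.sum_add_distrib]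
            exact Finset.sum_congr rfl fun e _ => by ring
        _ ≤ runProb s h * (z : ℝ) ^ 2 + 2 * z * (runProb s h * 6) +
            runProb s h * (8 / (k + 1) * sqChildCount h + 10) := by gcongr
        _ = runProb s h * ((z : ℝ) ^ 2 + 12 * z) +
            (8 / (k + 1) * (runProb s h * sqChildCount h) + 10 * runProb s h) := by ring
        _ ≤ _ := by
            have := runProb_nonneg s h
            gcongr
    have hone := sum_runProb_le_one s k
    have hS := sum_runProb_mul_sqChildCount_le s k
    -- By the first moment bound 6k. Each step thus adds at most 48 + 10 = 58.
    have h48 : 8 / ((k : ℝ) + 1) * ∑ h ∈ histories V k, runProb s h * sqChildCount h ≤ 48 := by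
      rw [div_mul_eq_mul_div, div_le_iff₀ (by positivity)]
      linarith
    refine (Finset.sum_le_sum hstep).trans ?_
    rw [Finset.sum_add_distrib, Finset.sum_add_distrib, ← Finset.mul_sum, ← Finset.mul_sum]
    push_cast
    linarith

/-- The squared excess over `6k` of the sum of squared numbers of children after `k` steps. -/
noncomputable def excessSq (k : ℕ) (s : V) (x : Edge V → ℝ) : ℝ :=
  ∑ h ∈ histories V k, (runSet s h).indicator (fun _ => ((sqChildCount h - 6 * k : ℕ) : ℝ) ^ 2) x

lemma measurable_excessSq (k : ℕ) : Measurable (excessSq (V := V) k s) :=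
  Finset.measurable_fun_sum _ fun h _ => measurable_const.indicator (measurableSet_runSet s h)

lemma excessSq_nonneg (k : ℕ) (x : Edge V → ℝ) : 0 ≤ excessSq k s x :=
  Finset.sum_nonneg fun _ _ => Set.indicator_nonneg (fun _ _ => by positivity) _

lemma integrable_excessSq (k : ℕ) : Integrable (excessSq (V := V) k s) (edgeMeasure V) :=
  integrable_finsetSum _ fun h _ => (integrable_const _).indicator (measurableSet_runSet s h)

lemma integral_excessSq_le (k : ℕ) : ∫ x, excessSq k s x ∂edgeMeasure V ≤ 58 * k := by
  refine le_trans (le_of_eq ?_) (sum_runProb_mul_excess_sq_le s k)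
  unfold excessSq
  rw [integral_finsetSum _ fun h _ =>
    (integrable_const _).indicator (measurableSet_runSet s h)]
  refine Finset.sum_congr rfl fun h _ => ?_
  rw [integral_indicator_const _ (measurableSet_runSet s h), smul_eq_mul, runProb]

/-- The event that the total squared excess is large. -/
def largeExcess (V : Type*) [Fintype V] [DecidableEq V] : Set (Edge V → ℝ) :=
  {x | (Fintype.card V : ℝ) ^ 3 ≤ ∑ s, excessSq (Fintype.card V - 1) s x}

/-- Markov's inequality: the total mean is at most n · 58n against the threshold n³. Only linearity
over sources is used, not independence. -/
lemma edgeMeasure_largeExcess_le [Nonempty V] :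
    (edgeMeasure V).real (largeExcess V) ≤ 58 / Fintype.card V := by
  have hn : (0 : ℝ) < Fintype.card V := by exact_mod_cast Fintype.card_pos
  have h1 := mul_meas_ge_le_integral_of_nonneg (μ := edgeMeasure V)
    (f := fun x => ∑ s, excessSq (Fintype.card V - 1) s x)
    (Filter.Eventually.of_forall fun x => Finset.sum_nonneg fun s _ => excessSq_nonneg s _ x)
    (integrable_finsetSum _ fun s _ => integrable_excessSq s _) ((Fintype.card V : ℝ) ^ 3)
  rw [integral_finsetSum _ fun s _ => integrable_excessSq s _] at h1
  have h2 : ∑ s : V, ∫ x, excessSq (Fintype.card V - 1) s x ∂edgeMeasure V ≤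
      ∑ s : V, 58 * (Fintype.card V : ℝ) := by
    refine Finset.sum_le_sum fun s _ => (integral_excessSq_le s _).trans ?_
    gcongr
    exact Nat.sub_le _ _
  rw [Finset.sum_const, Finset.card_univ, nsmul_eq_mul] at h2
  rw [le_div_iff₀ hn]
  have h3 := h1.trans h2
  have h4 : (Fintype.card V : ℝ) ^ 2 * ((edgeMeasure V).real (largeExcess V) * Fintype.card V) ≤
      (Fintype.card V : ℝ) ^ 2 * 58 := by
    refine le_trans (le_of_eq ?_) (h3.trans (le_of_eq ?_))
    · rw [largeExcess]
      ring
    · ring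
  exact le_of_mul_le_mul_left h4 (by positivity)

/-- By Cauchy–Schwarz the excesses sum to at most √(n · n³) = n², on top of the drift 6n². -/
lemma sum_sqChildCount_le {x : Edge V → ℝ} (hx : x ∉ largeExcess V) (R : V → List (V × V))
    (hlen : ∀ s, (R s).length = Fintype.card V - 1) (hrun : ∀ s, x ∈ runSet s (R s)) :
    ∑ s, sqChildCount (R s) ≤ 7 * Fintype.card V ^ 2 := by
  set n := Fintype.card V with hn
  set E : V → ℕ := fun s => sqChildCount (R s) - 6 * (n - 1) with hE
  have h1 : ∑ s, sqChildCount (R s) ≤ ∑ s, E s + 6 * n ^ 2 := by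
    calc ∑ s, sqChildCount (R s) ≤ ∑ s, (E s + 6 * n) :=
          Finset.sum_le_sum fun s _ => by simp only [hE]; omega
      _ = _ := by
        rw [Finset.sum_add_distrib, Finset.sum_const, Finset.card_univ, smul_eq_mul, ← hn]
        ring
  have h2 : ∑ s, (E s : ℝ) ^ 2 ≤ ∑ s, excessSq (n - 1) s x := by
    refine Finset.sum_le_sum fun s _ => ?_
    have := Finset.single_le_sum (s := histories V (n - 1)) (a := R s)
      (f := fun h => (runSet s h).indicator
        (fun _ => ((sqChildCount h - 6 * (n - 1) : ℕ) : ℝ) ^ 2) x)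
      (fun _ _ => Set.indicator_nonneg (fun _ _ => by positivity) _) (mem_histories.2 (hlen s))
    rwa [Set.indicator_of_mem (hrun s)] at this
  have h3 : (∑ s, (E s : ℝ)) ^ 2 ≤ n * ∑ s, (E s : ℝ) ^ 2 := by
    simpa [hn] using sq_sum_le_card_mul_sum_sq (s := (Finset.univ : Finset V))
      (f := fun s => (E s : ℝ))
  have h4 : ∑ s, excessSq (n - 1) s x < (n : ℝ) ^ 3 := not_le.1 hx
  have h5 : ∑ s, E s ≤ n ^ 2 := by
    have h6 : (∑ s, (E s : ℝ)) ^ 2 ≤ ((n : ℝ) ^ 2) ^ 2 := by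
      calc _ ≤ (n : ℝ) * ∑ s, (E s : ℝ) ^ 2 := h3
        _ ≤ n * (n : ℝ) ^ 3 := by
          gcongr
          exact h2.trans h4.le
        _ = _ := by ring
    have h7 := (sq_le_sq₀ (by positivity) (by positivity)).1 h6
    exact_mod_cast h7
  omega

end Moments

/-! ### Light two-edge paths, which keep all arrivals below 1/2. -/

section Short

variable {V : Type*} [Fintype V] [DecidableEq V]

/-- The event that no vertex of `T` is the middle of a path from `a` to `b` with two edges of
weight at most `1/4`. -/
def farSet (a b : V) (T : Finset V) : Set (Edge V → ℝ) :=
  {x | ∀ v ∈ T, ¬ (weight x a v ≤ 1 / 4 ∧ weight x v b ≤ 1 / 4)}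

lemma measurableSet_farSet (a b : V) (T : Finset V) : MeasurableSet (farSet a b T) := by
  refine Measurable.setOf (Measurable.forall fun v => Measurable.imp measurable_const
    (Measurable.not (Measurable.and ?_ ?_)))
  · exact measurable_le_prop (by fun_prop) (by fun_prop)
  · exact measurable_le_prop (by fun_prop) (by fun_prop)

lemma unifMeasure_Iic_quarter : unifMeasure (Set.Iic (1 / 4)) = ENNReal.ofReal (1 / 4) := by
  rw [Measure.restrict_apply measurableSet_Iic]
  have : Set.Iic (1 / 4 : ℝ) ∩ Set.Icc 0 1 = Set.Icc 0 (1 / 4) := by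
    ext r
    simp only [Set.mem_inter_iff, Set.mem_Iic, Set.mem_Icc]
    constructor
    · exact fun h => ⟨h.2.1, h.1⟩
    · exact fun h => ⟨h.2, h.1, by linarith [h.2]⟩
  rw [this, Real.volume_Icc, sub_zero]

/-- Different middle vertices use disjoint pairs of edges, and each pair fails with probability 1 -
(1/4)² = 15/16. -/
lemma edgeMeasure_farSet_le {a b : V} (T : Finset V) (ha : a ∉ T) (hb : b ∉ T) :
    edgeMeasure V (farSet a b T) ≤ ENNReal.ofReal (15 / 16) ^ T.card := by
  induction T using Finset.induction_on with
  | empty => simpa using prob_le_one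
  | insert v T hv ih =>
    simp only [Finset.mem_insert, not_or] at ha hb
    rw [Finset.card_insert_of_notMem hv, pow_succ']
    refine le_trans ?_ (mul_le_mul_right (ih ha.2 hb.2) _)
    set e₁ : Edge V := ⟨(a, v), ha.1⟩ with he₁
    set e₂ : Edge V := ⟨(v, b), Ne.symm hb.1⟩ with he₂
    have h12 : e₁ ≠ e₂ := fun h => ha.1 (congrArg (fun e : Edge V => e.1.1) h)
    refine edgeMeasure_le_of_lmarginal (measurableSet_farSet _ _ _) (measurableSet_farSet _ _ _)
      {e₁, e₂} ENNReal.ofReal_ne_top fun x => ?_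
    have hupd : ∀ y, Function.updateFinset x {e₁, e₂} y ∈ farSet a b T ↔ x ∈ farSet a b T := by
      refine fun y => forall₂_congr fun u hu => ?_
      have hau : a ≠ u := fun h => ha.2 (h ▸ hu)
      have hub : u ≠ b := fun h => hb.2 (h ▸ hu)
      have huv : u ≠ v := fun h => hv (h ▸ hu)
      rw [weight_of_ne _ hau, weight_of_ne _ hau, weight_of_ne _ hub, weight_of_ne _ hub,
        Function.updateFinset, dif_neg, Function.updateFinset, dif_neg]
      · simp only [he₁, he₂, Finset.mem_insert, Finset.mem_singleton, Subtype.mk.injEq,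
          Prod.mk.injEq]
        tauto
      · simp only [he₁, he₂, Finset.mem_insert, Finset.mem_singleton, Subtype.mk.injEq,
          Prod.mk.injEq]
        tauto
    by_cases hx : x ∈ farSet a b T
    · have hone : lmarginal (fun _ => unifMeasure) {e₁, e₂}
          ((farSet a b T).indicator fun _ => 1) x = 1 := by
        unfold lmarginal
        have : ∀ y, (farSet a b T).indicator (fun _ => (1 : ENNReal))
            (Function.updateFinset x {e₁, e₂} y) = 1 := fun y =>
          Set.indicator_of_mem ((hupd y).2 hx) _
        simp [this]
      rw [hone, mul_one]
      set Q : Set (({e₁, e₂} : Finset (Edge V)) → ℝ) := Set.univ.pi fun _ => Set.Iic (1 / 4)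
        with hQ
      have hQm : MeasurableSet Q := MeasurableSet.univ_pi fun _ => measurableSet_Iic
      have hle : lmarginal (fun _ => unifMeasure) {e₁, e₂}
          ((farSet a b (insert v T)).indicator fun _ => 1) x ≤
          ∫⁻ y, Qᶜ.indicator (fun _ => 1) y ∂Measure.pi fun _ => unifMeasure := by
        classical
        refine lintegral_mono fun y => ?_
        simp only [Set.indicator_apply]
        split_ifs with h1 h2 h2
        · rfl
        · have hyQ : y ∈ Q := not_not.1 h2
          refine absurd ?_ (h1 v (Finset.mem_insert_self _ _))
          rw [weight_of_ne _ ha.1, weight_of_ne _ (Ne.symm hb.1)]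
          constructor
          · have := hyQ ⟨e₁, by simp⟩ (Set.mem_univ _)
            rw [Function.updateFinset, dif_pos (by simp [he₁])]
            exact this
          · have := hyQ ⟨e₂, by simp⟩ (Set.mem_univ _)
            rw [Function.updateFinset, dif_pos (by simp [he₂])]
            exact this
        · exact zero_le
        · rfl
      refine hle.trans ?_
      rw [lintegral_indicator hQm.compl, setLIntegral_const, one_mul, prob_compl_eq_one_sub hQm,
        hQ, Measure.pi_pi]
      simp only [unifMeasure_Iic_quarter, Finset.prod_const, Finset.card_univ, Fintype.card_coe,
        Finset.card_pair h12]
      rw [← ENNReal.ofReal_pow (by norm_num), ← ENNReal.ofReal_one,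
        ← ENNReal.ofReal_sub _ (by norm_num)]
      apply ENNReal.ofReal_le_ofReal
      norm_num
    · have hzero : lmarginal (fun _ => unifMeasure) {e₁, e₂}
          ((farSet a b (insert v T)).indicator fun _ => 1) x = 0 := by
        unfold lmarginal
        rw [lintegral_eq_zero_of_ae_eq_zero]
        refine Filter.Eventually.of_forall fun y => Set.indicator_of_notMem (fun hy => hx ?_) _
        exact (hupd y).1 fun u hu => hy u (Finset.mem_insert_of_mem hu)
      rw [hzero]
      exact zero_le

/-- Any two vertices are joined by a path with two light edges. -/
def HasShortPaths (x : Edge V → ℝ) : Prop :=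
  ∀ a b, a ≠ b → ∃ v, v ≠ a ∧ v ≠ b ∧ weight x a v ≤ 1 / 4 ∧ weight x v b ≤ 1 / 4

lemma edgeMeasure_not_hasShortPaths_le :
    (edgeMeasure V).real {x | ¬ HasShortPaths x} ≤
      (Fintype.card V : ℝ) ^ 2 * (15 / 16) ^ (Fintype.card V - 2) := by
  have hsub : {x : Edge V → ℝ | ¬ HasShortPaths x} ⊆
      ⋃ e ∈ (Finset.univ : Finset (Edge V)), farSet e.1.1 e.1.2 ({e.1.1, e.1.2} : Finset V)ᶜ := by
    intro x hx
    change ¬ HasShortPaths x at hx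
    simp only [HasShortPaths, not_forall, not_exists] at hx
    obtain ⟨a, b, hab, hx⟩ := hx
    refine Set.mem_iUnion₂.2 ⟨⟨(a, b), hab⟩, Finset.mem_univ _, fun v hv h => hx v ?_⟩
    simp only [Finset.mem_compl, Finset.mem_insert, Finset.mem_singleton, not_or] at hv
    exact ⟨hv.1, hv.2, h⟩
  have hcard : (Fintype.card (Edge V) : ℝ) ≤ (Fintype.card V : ℝ) ^ 2 := by
    have h := Fintype.card_subtype_le fun e : V × V => e.1 ≠ e.2
    rw [Fintype.card_prod, ← sq] at h
    exact_mod_cast h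
  calc (edgeMeasure V).real {x | ¬ HasShortPaths x}
      ≤ (edgeMeasure V).real (⋃ e ∈ (Finset.univ : Finset (Edge V)),
          farSet e.1.1 e.1.2 ({e.1.1, e.1.2} : Finset V)ᶜ) :=
        measureReal_mono hsub (measure_ne_top _ _)
    _ ≤ ∑ e : Edge V, (edgeMeasure V).real (farSet e.1.1 e.1.2 ({e.1.1, e.1.2} : Finset V)ᶜ) :=
        measureReal_biUnion_finset_le _ _
    _ ≤ ∑ e : Edge V, (15 / 16 : ℝ) ^ (Fintype.card V - 2) := by
        refine Finset.sum_le_sum fun e _ => ?_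
        have h1 := ENNReal.toReal_mono (by simp)
          (edgeMeasure_farSet_le (a := e.1.1) (b := e.1.2) ({e.1.1, e.1.2} : Finset V)ᶜ
            (by simp) (by simp))
        rwa [ENNReal.toReal_pow, ENNReal.toReal_ofReal (by norm_num), Finset.card_compl,
          Finset.card_pair e.2] at h1
    _ ≤ _ := by
        rw [Finset.sum_const, Finset.card_univ, nsmul_eq_mul]
        gcongr

end Short

/-! ### Edge reversal, the good event, and the final estimate. -/

section Main

variable {V : Type*} [DecidableEq V]

/-- The reversal of edges. -/
def edgeSwap {V : Type*} : Edge V ≃ Edge V where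
  toFun e := ⟨(e.1.2, e.1.1), e.2.symm⟩
  invFun e := ⟨(e.1.2, e.1.1), e.2.symm⟩
  left_inv _ := rfl
  right_inv _ := rfl

/-- The reversal of all edges, acting on weights. -/
def reverseWeights : (Edge V → ℝ) ≃ᵐ (Edge V → ℝ) :=
  MeasurableEquiv.piCongrLeft (fun _ : Edge V => ℝ) edgeSwap

lemma weight_reverseWeights (x : Edge V → ℝ) :
    weight (reverseWeights x) = fun a b => weight x b a := by
  funext a b
  by_cases hab : a = b
  · simp [weight, hab]
  · rw [weight_of_ne _ hab, weight_of_ne _ (Ne.symm hab)]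
    exact Equiv.piCongrLeft_apply_apply (fun _ : Edge V => ℝ) edgeSwap x
      ⟨(b, a), Ne.symm hab⟩

variable [Fintype V]

/-- Weights for which all shortest path trees are well behaved. -/
def IsGood (x : Edge V → ℝ) : Prop :=
  HasNoTies (weight x) ∧ (∀ a b, a ≠ b → 0 < weight x a b) ∧ HasShortPaths x ∧ x ∉ largeExcess V

lemma edgeMeasure_not_isGood_le [Nonempty V] :
    (edgeMeasure V).real {x | ¬ IsGood x} ≤
      (Fintype.card V : ℝ) ^ 2 * (15 / 16) ^ (Fintype.card V - 2) + 58 / Fintype.card V := by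
  have hae : ({x | ¬ IsGood x} : Set (Edge V → ℝ)) ≤ᵐ[edgeMeasure V]
      ({x | ¬ HasShortPaths x} ∪ largeExcess V : Set (Edge V → ℝ)) := by
    filter_upwards [ae_hasNoTies (V := V), ae_weight_pos (V := V)] with x h1 h2 hx
    by_contra h3
    exact hx ⟨h1, h2, not_not.1 fun h => h3 (Or.inl h), fun h => h3 (Or.inr h)⟩
  calc (edgeMeasure V).real {x | ¬ IsGood x}
      ≤ (edgeMeasure V).real ({x | ¬ HasShortPaths x} ∪ largeExcess V) :=
        ENNReal.toReal_mono (measure_ne_top _ _) (measure_mono_ae hae)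
    _ ≤ _ := (measureReal_union_le _ _).trans
        (add_le_add edgeMeasure_not_hasShortPaths_le edgeMeasure_largeExcess_le)

lemma IsGood.exists_runs [Nonempty V] {x : Edge V → ℝ} (hx : IsGood x) :
    ∃ R : V → List (V × V), (∀ s, IsInner (weight x) s (R s)) ∧
      (∀ s v, v ∈ explored s (R s)) ∧ ∑ s, sqChildCount (R s) ≤ 7 * Fintype.card V ^ 2 := by
  obtain ⟨hties, hpos, hshort, hlarge⟩ := hx
  have hcard : 0 < Fintype.card V := Fintype.card_pos
  choose R hlen hrun using fun s => hties.exists_isRun hpos s (Fintype.card V - 1) (by omega)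
  have hfull : ∀ s v, v ∈ explored s (R s) := by
    intro s v
    have : explored s (R s) = Finset.univ := by
      rw [← Finset.card_eq_iff_eq_univ, (hrun s).1.isGrowth.card_explored, hlen]
      omega
    rw [this]
    exact Finset.mem_univ v
  refine ⟨R, fun s => (hrun s).1, hfull, sum_sqChildCount_le hlarge R hlen fun s => ⟨hrun s, ?_⟩⟩
  have := (hrun s).1.lastArrival_le hpos (hfull s) (by norm_num) hshort
  linarith

/-- Reversal permutes identically distributed independent coordinates; hence the bounds for
out-trees also serve for in-trees. -/
lemma measurePreserving_reverseWeights :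
    MeasurePreserving (reverseWeights (V := V)) (edgeMeasure V) (edgeMeasure V) :=
  measurePreserving_piCongrLeft (fun _ : Edge V => unifMeasure) edgeSwap

lemma IsGood.numLSP_le [Nonempty V] {x : Edge V → ℝ} (hx : IsGood x)
    (hx' : IsGood (reverseWeights x)) :
    2 * numLSP (weight x) ≤ ((16 * Fintype.card V ^ 2 : ℕ) : ℕ∞) := by
  obtain ⟨R, h1, h2, h3⟩ := hx.exists_runs
  obtain ⟨R', h1', h2', h3'⟩ := hx'.exists_runs
  rw [weight_reverseWeights] at h1'
  refine (two_mul_numLSP_le hx.2.1 R R' h1 h1' h2 h2').trans ?_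
  rw [Nat.cast_le]
  omega

lemma edgeMeasure_numLSP_le [Nonempty V] :
    (edgeMeasure V).real {x | ENNReal.ofReal (9 * (Fintype.card V : ℝ) ^ 2) ≤
      (numLSP (weight x) : ENNReal)} ≤
      2 * ((Fintype.card V : ℝ) ^ 2 * (15 / 16) ^ (Fintype.card V - 2) +
        58 / Fintype.card V) := by
  have hsub : {x : Edge V → ℝ | ENNReal.ofReal (9 * (Fintype.card V : ℝ) ^ 2) ≤
      (numLSP (weight x) : ENNReal)} ⊆
      {x | ¬ IsGood x} ∪ reverseWeights ⁻¹' {x | ¬ IsGood x} := by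
    intro x hx
    by_contra h
    simp only [Set.mem_union, not_or] at h
    have hle := (not_not.1 h.1).numLSP_le (not_not.1 h.2)
    change ENNReal.ofReal (9 * (Fintype.card V : ℝ) ^ 2) ≤ (numLSP (weight x) : ENNReal) at hx
    have hne : numLSP (weight x) ≠ ⊤ := by
      intro htop
      rw [htop, ENat.mul_top (by norm_num), top_le_iff] at hle
      exact ENat.natCast_ne_top _ hle
    obtain ⟨m, hm⟩ := ENat.ne_top_iff_exists.1 hne
    rw [← hm] at hle hx
    have h1 : 2 * m ≤ 16 * Fintype.card V ^ 2 := by exact_mod_cast hle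
    rw [ENat.toENNReal_coe, ENNReal.ofReal_le_natCast] at hx
    have h2 : 9 * Fintype.card V ^ 2 ≤ m := by exact_mod_cast hx
    have h3 : 0 < Fintype.card V ^ 2 := pow_pos Fintype.card_pos 2
    omega
  refine (measureReal_mono hsub).trans ((measureReal_union_le _ _).trans ?_)
  -- For a measurable equivalence this holds for every set, so `IsGood` need not be a measurable
  -- event.
  rw [measureReal_def, measureReal_def,
    (measurePreserving_reverseWeights (V := V)).measure_preimage_equiv]
  have := edgeMeasure_not_isGood_le (V := V)
  rw [measureReal_def] at this
  linarith

lemma map_eq_unifMeasure {Ω : Type*} [MeasurableSpace Ω] {μ : Measure Ω} {X : Ω → ℝ}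
    (hX : pdf.IsUniform X (Set.Icc 0 1) μ) : μ.map X = unifMeasure := by
  rw [pdf.IsUniform, ProbabilityTheory.cond] at hX
  simpa using hX

lemma exists_pow_mul_le : ∃ K : ℝ, 0 ≤ K ∧ ∀ n : ℕ, 1 ≤ n →
    2 * ((n : ℝ) ^ 2 * (15 / 16) ^ (n - 2) + 58 / n) ≤ K / n := by
  obtain ⟨B, hB⟩ := (tendsto_pow_const_mul_const_pow_of_abs_lt_one 3
    (r := (15 / 16 : ℝ)) (by rw [abs_of_pos] <;> norm_num)).bddAbove_range
  have hB' : ∀ n : ℕ, (n : ℝ) ^ 3 * (15 / 16) ^ n ≤ B := fun n => hB ⟨n, rfl⟩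
  have hB0 : 0 ≤ B := by simpa using hB' 0
  refine ⟨2 * ((16 / 15) ^ 2 * B + 58), by positivity, fun n hn => ?_⟩
  have hn' : (0 : ℝ) < n := by exact_mod_cast hn
  rw [le_div_iff₀ hn']
  have h1 : (15 / 16 : ℝ) ^ (n - 2) ≤ (16 / 15) ^ 2 * (15 / 16) ^ n := by
    -- For n < 2 the subtraction truncates, so only n ≤ n - 2 + 2 is available; a base below 1 makes
    -- this suffice.
    have : (15 / 16 : ℝ) ^ (n - 2 + 2) ≤ (15 / 16) ^ n :=
      pow_le_pow_of_le_one (by norm_num) (by norm_num) (by omega)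
    rw [pow_add] at this
    linarith
  have h2 : (n : ℝ) ^ 3 * (15 / 16) ^ (n - 2) ≤ (16 / 15) ^ 2 * B := by
    calc _ ≤ (n : ℝ) ^ 3 * ((16 / 15) ^ 2 * (15 / 16) ^ n) := by gcongr
      _ = (16 / 15) ^ 2 * ((n : ℝ) ^ 3 * (15 / 16) ^ n) := by ring
      _ ≤ _ := by
        gcongr
        exact hB' n
  have h3 : 2 * ((n : ℝ) ^ 2 * (15 / 16) ^ (n - 2) + 58 / n) * n =
      2 * ((n : ℝ) ^ 3 * (15 / 16) ^ (n - 2) + 58) := by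
    field_simp
  rw [h3]
  linarith

end Main

end RandomAPSP

theorem mainTheorem1 :
    ∃ c : ℝ, 0 < c ∧ ∃ C : ℝ, ∀ n : ℕ, 1 ≤ n →
      ∀ {Ω : Type*} [MeasurableSpace Ω] (μ : Measure Ω) [IsProbabilityMeasure μ]
        (W : Fin n → Fin n → Ω → ℝ),
        iIndepFun (fun e : {e : Fin n × Fin n // e.1 ≠ e.2} => W e.1.1 e.1.2) μ →
        (∀ a b : Fin n, a ≠ b → pdf.IsUniform (W a b) (Set.Icc 0 1) μ) →
        μ.real {ω | ENNReal.ofReal (c * (n : ℝ) ^ 2) ≤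
            (RandomAPSP.numLSP (fun a b => W a b ω) : ENNReal)} ≤
          C * (n : ℝ) ^ (-(1 / 26) : ℝ) := by
  obtain ⟨K, hK0, hK⟩ := RandomAPSP.exists_pow_mul_le
  -- Good weights give 2|LSP| ≤ (2 + 7 + 7)n², hence |LSP| ≤ 8n² < 9n².
  refine ⟨9, by norm_num, K, fun n hn Ω _ μ _ W hind hunif => ?_⟩
  have : Nonempty (Fin n) := ⟨⟨0, hn⟩⟩
  set X : Ω → RandomAPSP.Edge (Fin n) → ℝ := fun ω e => W e.1.1 e.1.2 ω with hX
  have hmeas : ∀ e : RandomAPSP.Edge (Fin n), AEMeasurable (W e.1.1 e.1.2) μ := fun e =>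
    (hunif _ _ e.2).aemeasurable (by simp) (by simp)
  have hmap : μ.map X = RandomAPSP.edgeMeasure (Fin n) := by
    rw [hX, (iIndepFun_iff_map_fun_eq_pi_map hmeas).1 hind]
    congr 1
    funext e
    exact RandomAPSP.map_eq_unifMeasure (hunif _ _ e.2)
  have hset : {ω | ENNReal.ofReal (9 * (n : ℝ) ^ 2) ≤
      (RandomAPSP.numLSP (fun a b => W a b ω) : ENNReal)} =
      X ⁻¹' {x | ENNReal.ofReal (9 * (n : ℝ) ^ 2) ≤
        (RandomAPSP.numLSP (RandomAPSP.weight x) : ENNReal)} := by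
    ext ω
    have : RandomAPSP.numLSP (fun a b => W a b ω) =
        RandomAPSP.numLSP (RandomAPSP.weight (X ω)) :=
      RandomAPSP.numLSP_congr fun a b hab => (RandomAPSP.weight_of_ne (X ω) hab).symm
    change ENNReal.ofReal (9 * (n : ℝ) ^ 2) ≤
      (RandomAPSP.numLSP (fun a b => W a b ω) : ENNReal) ↔ _
    rw [this]
    exact Iff.rfl
  have hbound := RandomAPSP.edgeMeasure_numLSP_le (V := Fin n)
  rw [Fintype.card_fin, ← hmap] at hbound
  rw [hset]
  have hn' : (1 : ℝ) ≤ n := by exact_mod_cast hn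
  have : IsProbabilityMeasure (μ.map X) := by
    rw [hmap]
    infer_instance
  -- Only this direction is needed, and it holds without measurability of the event.
  calc _ ≤ (μ.map X).real _ := ENNReal.toReal_mono (measure_ne_top _ _)
        (Measure.le_map_apply (aemeasurable_pi_lambda _ hmeas) _)
    _ ≤ _ := hbound
    _ ≤ K / n := hK n hn
    _ = K * (n : ℝ) ^ (-1 : ℝ) := by rw [Real.rpow_neg_one, div_eq_mul_inv]
    _ ≤ _ := by
        gcongr
        norm_num
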